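/- Let $n\ge 1$, $s\in(0,1)$, $\gamma\in(0,1]$ with $n\neq 2s$, let $\Omega\subset\mathbb R^n$ be a non-empty bounded open set, and put $\delta(x)=\operatorname{dist}(x,\partial\Omega)$. Let $L^1(\Omega;\delta^\gamma)$ be the space of measurable $f$ on $\Omega$ with $\int_\Omega|f|\,\delta^\gamma\,dx<\infty$, and let $\delta^\gamma L^\infty(\Omega)$ be the set of measurable $\psi$ on $\Omega$ with $|\psi|\le C\delta^\gamma$ a.e. in $\Omega$ for some constant $C$. Let $\mathcal L:\operatorname{dom}\mathcal L\subset L^2(\Omega)\to L^2(\Omega)$ be a linear operator with $\langle\mathcal Lu,u\rangle\ge0$ for all $u\in\operatorname{dom}\mathcal L$, satisfying the following assumption (K1): $\mathcal L$ has a Green's function, that is, there is a measurable function $\mathcal G_0:\{(x,y)\in\Omega\times\Omega:x\ne y\}\to(0,\infty)$ such that the operator $$\mathbb G_0(f)(x)=\int_\Omega\mathcal G_0(x,y)f(y)\,dy$$ on $L^2(\Omega)$ is the two-sided inverse of $\mathcal L$ (in particular $\operatorname{dom}\mathcal L=\mathbb G_0(L^2(\Omega))$); moreover $\mathcal G_0(x,y)=\mathcal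 G_0(y,x)$, and there is $C>0$ with $C^{-1}k\le \mathcal G_0\le Ck$ for all $x\neq y$ in $\Omega$, where $$k(x,y)=\frac1{|x-y|^{n-2s}}\Big(\frac{\delta(x)^\gamma}{|x-y|^\gamma}\wedge1\Big)\Big(\frac{\delta(y)^\gamma}{|x-y|^\gamma}\wedge1\Big).$$ Then $\mathbb G_0(g)(x)$ is given by an absolutely convergent integral for a.e. $x\in\Omega$, for every $g\in L^1(\Omega;\delta^\gamma)$, and $L^2(\Omega)$ has an orthonormal basis $(\varphi_j)_{j\ge1}$ of eigenfunctions of $\mathcal L$, $\mathcal L\varphi_j=\lambda_j\varphi_j$, with $0<\lambda_1\le\lambda_2\le\cdots\nearrow+\infty$. Fix any such basis and any $\lambda\in\mathbb R\setminus\{\lambda_j:j\ge1\}$. Then the series $$\mathbb G_\lambda(g)=\sum_{j\ge1}\frac{\langle g,\varphi_j\rangle}{\lambda_j-\lambda}\varphi_j$$ converges in $L^2(\Omega)$ for every $g\in L^2(\Omega)$, and the operator $\mathbb G_\lambda$ has a unique extension to a bounded linear operator, still denoted $\mathbb G_\lambda$, from $L^1(\Omega;\delta^\gamma)$ to itself.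 For all $f,u\in L^1(\Omega;\delta^\gamma)$ the following five notions of solution of $\mathcal Lu-\lambda u=f$ in $\Omega$, with zero boundary data, are equivalent: 1. ($\mathbb G_\lambda$-Green solution) $u=\mathbb G_\lambda(f)$ a.e. in $\Omega$; 2. ($\mathbb G_\lambda(\delta^\gamma L^\infty)$-weak solution) $\int_\Omega u\psi\,dx=\int_\Omega f\,\mathbb G_\lambda(\psi)\,dx$ for all $\psi\in\delta^\gamma L^\infty(\Omega)$; 3. ($\mathbb G_0(L^\infty_c)$-weak solution) $\int_\Omega u(\psi-\lambda\mathbb G_0(\psi))\,dx=\int_\Omega f\,\mathbb G_0(\psi)\,dx$ for all bounded measurable $\psi$ with compact support in $\Omega$; 4. ($\mathbb G_0(C^\infty_c)$-weak solution) the identity in 3 holds for all $\psi\in C_c^\infty(\Omega)$; 5. ($\mathbb G_0$-Green solution) $u=\lambda\mathbb G_0(u)+\mathbb G_0(f)$ a.e. in $\Omega$. Here the validity of an identity includes the absolute convergence of the integrals in it. If in addition $f\in L^2(\Omega)$ and $u\in\mathbb H^2_{\mathcal L}(\Omega)=\{v\in L^2(\Omega):\sum_{j}\lambda_j^2\langle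 v,\varphi_j\rangle^2<\infty\}$, then each of 1–5 is also equivalent to 6. (spectral solution) $(\lambda_j-\lambda)\int_\Omega u\varphi_j\,dx=\int_\Omega f\varphi_j\,dx$ for all $j\ge1$. -/

import Mathlib

open MeasureTheory Filter Topology Set
open scoped ContDiff ENNReal

namespace GreenNotions

noncomputable section

/-- `ℝⁿ` with the Euclidean norm. -/
abbrev E (n : ℕ) : Type := EuclideanSpace ℝ (Fin n)

variable {n : ℕ}

/-- The distance `δ(x) = dist(x, ∂Ω)`. -/
def bdist (Ω : Set (E n)) (x : E n) : ℝ := Metric.infDist x (frontier Ω)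

/-- `L²(Ω)`. -/
abbrev L2 (Ω : Set (E n)) : Type := Lp ℝ 2 (volume.restrict Ω)

/-- The measure `δ(x)^γ dx` on `Ω`. -/
def weightedMeasure (Ω : Set (E n)) (γ : ℝ) : Measure (E n) :=
  (volume.restrict Ω).withDensity (fun x => ENNReal.ofReal (bdist Ω x ^ γ))

/-- The weighted Lebesgue space `L¹(Ω; δ^γ)`, with norm `‖f‖ = ∫_Ω |f| δ^γ dx`. -/
abbrev WL1 (Ω : Set (E n)) (γ : ℝ) : Type := Lp ℝ 1 (weightedMeasure Ω γ)

/-- The reference kernel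
`|x-y|^{-(n-2s)} (δ^γ(x)/|x-y|^γ ∧ 1) (δ^γ(y)/|x-y|^γ ∧ 1)`. -/
def refKernel (Ω : Set (E n)) (s γ : ℝ) (x y : E n) : ℝ :=
  1 / ‖x - y‖ ^ ((n : ℝ) - 2 * s) *
    min (bdist Ω x ^ γ / ‖x - y‖ ^ γ) 1 * min (bdist Ω y ^ γ / ‖x - y‖ ^ γ) 1

/-- Green's operator `𝔾₀(f)(x) = ∫_Ω 𝒢₀(x,y) f(y) dy` with kernel `𝒢₀ = G`. -/
def greenOp (Ω : Set (E n)) (G : E n → E n → ℝ) (f : E n → ℝ) (x : E n) : ℝ :=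
  ∫ y in Ω, G x y * f y

/-- The integral defining `𝔾₀(f)(x)` converges absolutely for almost every `x ∈ Ω`. -/
def GreenDefined (Ω : Set (E n)) (G : E n → E n → ℝ) (f : E n → ℝ) : Prop :=
  ∀ᵐ x ∂(volume.restrict Ω), Integrable (fun y => G x y * f y) (volume.restrict Ω)

/-- `G` is the Green's function of the operator `L` on `L²(Ω)`: the Green's operator with
kernel `G` is a two-sided inverse of `L : dom L → L²(Ω)`. -/
structure IsGreenFunction (Ω : Set (E n)) (L : L2 Ω →ₗ.[ℝ] L2 Ω)
    (G : E n → E n → ℝ) : Prop where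
  defined : ∀ f : L2 Ω, GreenDefined Ω G f
  right_inv : ∀ f : L2 Ω, ∃ u : L.domain,
    ((u : L2 Ω) : E n → ℝ) =ᵐ[volume.restrict Ω] greenOp Ω G f ∧ L u = f
  left_inv : ∀ u : L.domain,
    ((u : L2 Ω) : E n → ℝ) =ᵐ[volume.restrict Ω] greenOp Ω G (L u : L2 Ω)

/-- `L` is non-negative on `L²(Ω)` and has a (measurable) symmetric positive Green's function
`G`, defined off the diagonal, which is comparable to the reference kernel. -/
structure K1 (Ω : Set (E n)) (s γ : ℝ) (L : L2 Ω →ₗ.[ℝ] L2 Ω)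
    (G : E n → E n → ℝ) : Prop where
  nonneg : ∀ u : L.domain, 0 ≤ inner ℝ (L u) (u : L2 Ω)
  measurable : AEStronglyMeasurable (fun p : E n × E n => G p.1 p.2)
    ((volume.restrict Ω).prod (volume.restrict Ω))
  green : IsGreenFunction Ω L G
  pos : ∀ x ∈ Ω, ∀ y ∈ Ω, x ≠ y → 0 < G x y
  symm : ∀ x ∈ Ω, ∀ y ∈ Ω, x ≠ y → G x y = G y x
  comparable : ∃ C : ℝ, 0 < C ∧ ∀ x ∈ Ω, ∀ y ∈ Ω, x ≠ y →
    C⁻¹ * refKernel Ω s γ x y ≤ G x y ∧ G x y ≤ C * refKernel Ω s γ x y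

/-- `(φ_j)` is an orthonormal basis of `L²(Ω)` of eigenfunctions of `L` with eigenvalues
`0 < lam 0 ≤ lam 1 ≤ ⋯ ↗ +∞`, repeated according to multiplicity. -/
structure IsEigenbasis {Ω : Set (E n)} (L : L2 Ω →ₗ.[ℝ] L2 Ω) (lam : ℕ → ℝ)
    (φ : HilbertBasis ℕ ℝ (L2 Ω)) : Prop where
  pos : ∀ j, 0 < lam j
  mono : Monotone lam
  tendsto : Tendsto lam atTop atTop
  eigen : ∀ j, ∃ h : φ j ∈ L.domain, L ⟨φ j, h⟩ = lam j • φ j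

/-- The `j`-th term of the series for `𝔾_μ(g)`. -/
def resolventTerm {Ω : Set (E n)} (lam : ℕ → ℝ) (φ : HilbertBasis ℕ ℝ (L2 Ω)) (μ : ℝ)
    (g : L2 Ω) (j : ℕ) : L2 Ω :=
  (inner ℝ g (φ j) / (lam j - μ)) • φ j

/-- `𝔾_μ(g) = ∑_j ⟨g, φ_j⟩ / (λ_j - μ) φ_j` on `L²(Ω)`. -/
def resolventL2 {Ω : Set (E n)} (lam : ℕ → ℝ) (φ : HilbertBasis ℕ ℝ (L2 Ω)) (μ : ℝ)
    (g : L2 Ω) : L2 Ω :=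
  ∑' j, resolventTerm lam φ μ g j

/-- The bounded operator `T` on `L¹(Ω; δ^γ)` extends `𝔾_μ` from `L²(Ω)`. -/
def IsResolventExtension {Ω : Set (E n)} {γ : ℝ} (lam : ℕ → ℝ)
    (φ : HilbertBasis ℕ ℝ (L2 Ω)) (μ : ℝ) (T : WL1 Ω γ →L[ℝ] WL1 Ω γ) : Prop :=
  ∀ (g : L2 Ω) (g' : WL1 Ω γ), (g' : E n → ℝ) =ᵐ[volume.restrict Ω] g →
    (T g' : E n → ℝ) =ᵐ[volume.restrict Ω] resolventL2 lam φ μ g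

/-- `δ^γ L^∞(Ω)`; since `Ω` is bounded, it is a subspace of `L²(Ω)`. -/
def weightedLinfty (Ω : Set (E n)) (γ : ℝ) : Set (L2 Ω) :=
  {ψ | ∃ C : ℝ, ∀ᵐ x ∂(volume.restrict Ω), |ψ x| ≤ C * bdist Ω x ^ γ}

/-- `L_c^∞(Ω)`: bounded measurable functions vanishing (a.e.) outside a compact subset
of `Ω`. -/
structure MemLinftyC (Ω : Set (E n)) (ψ : E n → ℝ) : Prop where
  meas : AEStronglyMeasurable ψ (volume.restrict Ω)
  bounded : ∃ C : ℝ, ∀ᵐ x ∂(volume.restrict Ω), |ψ x| ≤ C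
  support : ∃ K : Set (E n), IsCompact K ∧ K ⊆ Ω ∧
    ∀ᵐ x ∂(volume.restrict Ω), x ∉ K → ψ x = 0

/-- `C_c^∞(Ω)`. -/
structure MemSmoothC (Ω : Set (E n)) (ψ : E n → ℝ) : Prop where
  smooth : ContDiff ℝ ∞ ψ
  compact : HasCompactSupport ψ
  support : tsupport ψ ⊆ Ω

/-- `u` is a `𝔾_μ`-Green solution: `u = 𝔾_μ(f)` a.e. in `Ω`, where `T` is `𝔾_μ` on
`L¹(Ω; δ^γ)`. -/
def IsResolventGreenSol {Ω : Set (E n)} {γ : ℝ} (T : WL1 Ω γ →L[ℝ] WL1 Ω γ)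
    (f u : WL1 Ω γ) : Prop :=
  (u : E n → ℝ) =ᵐ[volume.restrict Ω] T f

/-- `u` is a `𝔾_μ(δ^γ L^∞(Ω))`-weak solution: for every `ψ ∈ δ^γ L^∞(Ω)`,
`∫ u ψ = ∫ f 𝔾_μ(ψ)`, both integrals being absolutely convergent. -/
def IsResolventWeakSol {Ω : Set (E n)} {γ : ℝ} (lam : ℕ → ℝ) (φ : HilbertBasis ℕ ℝ (L2 Ω))
    (μ : ℝ) (f u : WL1 Ω γ) : Prop :=
  ∀ ψ ∈ weightedLinfty Ω γ,
    IntegrableOn (fun x => u x * ψ x) Ω ∧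
    IntegrableOn (fun x => f x * resolventL2 lam φ μ ψ x) Ω ∧
    ∫ x in Ω, u x * ψ x = ∫ x in Ω, f x * resolventL2 lam φ μ ψ x

/-- `u` is a `𝔾₀(𝒯)`-weak solution for the class `𝒯` of functions: for every `ψ` in the class,
`∫ u (ψ - μ 𝔾₀(ψ)) = ∫ f 𝔾₀(ψ)`, both integrals being absolutely convergent. -/
def IsGreenWeakSol {Ω : Set (E n)} {γ : ℝ} (G : E n → E n → ℝ) (𝒯 : (E n → ℝ) → Prop)
    (μ : ℝ) (f u : WL1 Ω γ) : Prop :=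
  ∀ ψ : E n → ℝ, 𝒯 ψ →
    IntegrableOn (fun x => u x * (ψ x - μ * greenOp Ω G ψ x)) Ω ∧
    IntegrableOn (fun x => f x * greenOp Ω G ψ x) Ω ∧
    ∫ x in Ω, u x * (ψ x - μ * greenOp Ω G ψ x) = ∫ x in Ω, f x * greenOp Ω G ψ x

/-- `u` is a `𝔾₀`-Green solution: `u = μ 𝔾₀(u) + 𝔾₀(f)` a.e. in `Ω`. -/
def IsGreenSol {Ω : Set (E n)} {γ : ℝ} (G : E n → E n → ℝ) (μ : ℝ) (f u : WL1 Ω γ) : Prop :=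
  GreenDefined Ω G u ∧ GreenDefined Ω G f ∧
  ∀ᵐ x ∂(volume.restrict Ω), u x = μ * greenOp Ω G u x + greenOp Ω G f x

/-- `v ∈ ℍ²_L(Ω)`: `v ∈ L²(Ω)` and `∑_j λ_j² ⟨v, φ_j⟩² < ∞`. -/
def MemH2 {Ω : Set (E n)} (lam : ℕ → ℝ) (φ : HilbertBasis ℕ ℝ (L2 Ω)) (v : E n → ℝ) : Prop :=
  MemLp v 2 (volume.restrict Ω) ∧
    Summable (fun j => lam j ^ 2 * (∫ x in Ω, v x * φ j x) ^ 2)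

/-- `u` is a spectral solution: `(λ_j - μ) ∫ u φ_j = ∫ f φ_j` for all `j`. -/
def IsSpectralSol {Ω : Set (E n)} (lam : ℕ → ℝ) (φ : HilbertBasis ℕ ℝ (L2 Ω)) (μ : ℝ)
    (f u : E n → ℝ) : Prop :=
  ∀ j, (lam j - μ) * ∫ x in Ω, u x * φ j x = ∫ x in Ω, f x * φ j x

end

end GreenNotions

/-! ### Spectral theory of compact operators and an abstract extension of resolvents -/

namespace GreenNotions

/-! Each notion of solution reduces to a single equation in `L¹(Ω; δ^γ)`, namely `u = T f`, or
equivalently `u = μ A' u + A' f`. Here `A'` is the Green operator on that space, `A` is the Green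
operator on `L²`, `j` is the inclusion of `L²`, `Γ` is the resolvent on `L²`, and `T` is its
extension.

The kernel is controlled by `C|x-y|^(2s-n)`, and since `δ(x)^γ ≤ δ(y)^γ + |x-y|^γ` this control
survives conjugation with the weight. Schur's test then bounds `A` and `A'`
(`K1.exists_kernelBound`, `exists_isKernelOp`). Cutting the kernel at distance `ε` from the diagonal
leaves a near part, small in norm on both spaces, and a far part bounded by `M δ(y)^γ`, which maps
`L¹(Ω; δ^γ)` into `L²` and is Hilbert-Schmidt on `L²` (`K1.exists_green_operators`).

This splitting is used twice. It makes `A` a norm limit of compact operators, so the spectral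
theorem gives the eigenbasis. It also extends the resolvent: the near part is inverted by a Neumann
series, and the far part lands in `L²`, where the resolvent is already known
(`exists_intertwined_resolvent`). Density of `L²` gives uniqueness and carries the resolvent
identities over, and these turn `u = T f` into `u = μ A' u + A' f` (`eq_resolvent_iff`).

The weak notions follow by duality. Boundedness of `T` forces `Γ` to preserve `δ^γ L^∞`
(`resolvent_boundedByWeight`). Fubini and the symmetry of the kernel move `A'` onto the test
function, so the weak identity says that the residual `u - μ A' u - A' f` is orthogonal to the test
class (`K1.integral_weak_form`); smooth test functions already force it to vanish. -/

theorem exists_nat_equiv_monotone {ι : Type*} [Infinite ι] (f : ι → ℝ)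
    (hf : ∀ c, {i | f i ≤ c}.Finite) : ∃ e : ℕ ≃ ι, Monotone (f ∘ e) := by
  classical
  have hc : Countable ι := by
    rw [← Set.countable_univ_iff]
    have : (univ : Set ι) = ⋃ k : ℕ, {i | f i ≤ k} := by
      ext i
      simpa using exists_nat_ge (f i)
    rw [this]
    exact countable_iUnion fun k => (hf k).countable
  obtain ⟨enc, henc⟩ := exists_injective_nat ι
  -- An injection into `ℕ` breaks ties, so the pulled-back order is linear. Its initial segments are
  -- finite, which makes it isomorphic to `ℕ`.
  let key : ι → ℝ ×ₗ ℕ := fun i => toLex (f i, enc i)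
  have hkey : Function.Injective key := fun i j h => by
    have : (f i, enc i) = (f j, enc j) := toLex.injective h
    exact henc (Prod.ext_iff.1 this).2
  let _ : LinearOrder ι := LinearOrder.lift' key hkey
  have hle : ∀ {i j : ι}, i ≤ j → f i ≤ f j := fun {i j} h => by
    have h' : key i ≤ key j := h
    rcases (Prod.Lex.le_iff (α := ℝ) (β := ℕ)).1 h' with h1 | h1
    · exact le_of_lt h1
    · exact le_of_eq h1.1
  have hIic : ∀ i : ι, (Iic i).Finite := fun i => (hf (f i)).subset fun j hj => hle hj
  let _ : LocallyFiniteOrder ι :=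
    LocallyFiniteOrder.ofFiniteIcc fun a b => (hIic b).subset fun x hx => hx.2
  have : NoMaxOrder ι := ⟨fun a => by
    by_contra! h
    exact infinite_univ ((hIic a).subset fun x _ => h x)⟩
  obtain ⟨b, hb⟩ : ∃ b : ι, ∀ a, b ≤ a := by
    obtain ⟨i⟩ := (inferInstance : Nonempty ι)
    obtain ⟨b, hb, hb'⟩ := (hIic i).exists_minimal ⟨i, le_refl i⟩
    refine ⟨b, fun a => ?_⟩
    rcases le_total b a with h | h
    · exact h
    · exact hb' (h.trans hb) h
  let _ : OrderBot ι := { bot := b, bot_le := hb }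
  let _ : SuccOrder ι := LinearLocallyFiniteOrder.succOrder ι
  let _ : PredOrder ι := LinearLocallyFiniteOrder.predOrder ι
  let e := (orderIsoNatOfLinearSuccPredArch (ι := ι)).symm
  exact ⟨e.toEquiv, fun a b h => hle (e.monotone h)⟩

section Hilbert

variable {H : Type*} [NormedAddCommGroup H] [InnerProductSpace ℝ H] [CompleteSpace H]

/-- Hilbert-Schmidt criterion: by Cauchy-Schwarz and Bessel, the rank-one series `∑ ⟨e i, ·⟩ B (e
i)` is Cauchy in operator norm, and its sum is `B`. -/
theorem isCompactOperator_of_sum_norm_sq_le {ι : Type*} (e : HilbertBasis ι ℝ H) (B : H →L[ℝ] H)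
    (M : ℝ) (hM : ∀ F : Finset ι, ∑ i ∈ F, ‖B (e i)‖ ^ 2 ≤ M) : IsCompactOperator B := by
  let r : ι → (H →L[ℝ] H) := fun i => (innerSL ℝ (e i)).smulRight (B (e i))
  have hsq : Summable fun i => ‖B (e i)‖ ^ 2 :=
    summable_of_sum_le (fun i => by positivity) hM
  have hnorm : ∀ F : Finset ι, ‖∑ i ∈ F, r i‖ ^ 2 ≤ ∑ i ∈ F, ‖B (e i)‖ ^ 2 := by
    intro F
    have h0 : 0 ≤ ∑ i ∈ F, ‖B (e i)‖ ^ 2 := Finset.sum_nonneg fun i _ => by positivity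
    rw [← Real.sq_sqrt h0]
    refine pow_le_pow_left₀ (norm_nonneg _) ?_ 2
    refine ContinuousLinearMap.opNorm_le_bound _ (Real.sqrt_nonneg _) fun x => ?_
    have hx : (∑ i ∈ F, r i) x = ∑ i ∈ F, (inner ℝ (e i) x) • B (e i) := by
      simp [r]
    rw [hx]
    have h1 : ‖∑ i ∈ F, (inner ℝ (e i) x) • B (e i)‖ ≤ ∑ i ∈ F, ‖B (e i)‖ * ‖inner ℝ (e i) x‖ :=
      (norm_sum_le _ _).trans (Finset.sum_le_sum fun i _ => by rw [norm_smul, mul_comm])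
    have h2 := Finset.sum_mul_sq_le_sq_mul_sq F (fun i => ‖B (e i)‖) (fun i => ‖inner ℝ (e i) x‖)
    have h3 := e.orthonormal.sum_inner_products_le x (s := F)
    refine h1.trans (abs_le_of_sq_le_sq' ?_ (by positivity)).2
    rw [mul_pow, Real.sq_sqrt h0]
    exact h2.trans (mul_le_mul_of_nonneg_left h3 h0)
  have hsum : Summable r := by
    rw [summable_iff_vanishing_norm]
    intro ε hε
    obtain ⟨s, hs⟩ := summable_iff_vanishing_norm.1 hsq (ε ^ 2) (by positivity)
    refine ⟨s, fun t ht => lt_of_pow_lt_pow_left₀ 2 hε.le ((hnorm t).trans_lt ?_)⟩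
    exact (le_abs_self _).trans_lt (hs t ht)
  have hB : HasSum r B := by
    have h1 := hsum.hasSum
    have : (∑' i, r i) = B := by
      ext x
      have h2 : HasSum (fun i => r i x) ((∑' i, r i) x) :=
        h1.mapL (ContinuousLinearMap.apply ℝ H x)
      have h3 := (e.hasSum_repr x).mapL B
      refine h2.unique (h3.congr_fun ?_)
      intro i
      simp [r, e.repr_apply_apply]
    rwa [this] at h1
  classical
  refine isCompactOperator_of_tendsto hB (Eventually.of_forall fun F => ?_)
  induction F using Finset.induction_on with
  | empty => simpa using isCompactOperator_zero
  | insert a F ha ih =>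
    rw [Finset.sum_insert ha]
    refine IsCompactOperator.add ?_ ih
    have h1 : IsCompactOperator (ContinuousLinearMap.toSpanSingleton ℝ (B (e a))) :=
      isCompactOperator_of_locallyCompactSpace_rng _
    exact h1.comp_clm (innerSL ℝ (e a))

omit [CompleteSpace H] in
-- Images of distinct orthonormal eigenvectors with eigenvalues at least `ε` are more than `ε`
-- apart, so infinitely many of them could not lie in a compact set.
theorem finite_setOf_le_eigenvalue_of_isCompactOperator {ι : Type*} {A : H →L[ℝ] H}
    (hA : IsCompactOperator A) {v : ι → H} (hv : Orthonormal ℝ v) {a : ι → ℝ}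
    (hav : ∀ i, A (v i) = a i • v i) {ε : ℝ} (hε : 0 < ε) : {i | ε ≤ a i}.Finite := by
  by_contra hinf
  have hinf : {i | ε ≤ a i}.Infinite := hinf
  let f := hinf.natEmbedding
  have hK := hA.isCompact_closure_image_closedBall 1
  have hmem : ∀ k, A (v (f k)) ∈ closure (A '' Metric.closedBall 0 1) := fun k =>
    subset_closure ⟨_, by simp [hv.1], rfl⟩
  obtain ⟨x, -, φ, hφ, hx⟩ := hK.tendsto_subseq hmem
  have hc := hx.cauchySeq
  obtain ⟨N, hN⟩ := Metric.cauchySeq_iff.1 hc ε hε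
  have h1 := hN N le_rfl (N + 1) (Nat.le_succ N)
  have hne : (f (φ N) : ι) ≠ f (φ (N + 1)) := fun h =>
    (Nat.succ_ne_self N) (hφ.injective (f.injective (Subtype.ext h))).symm
  have h2 : ε ≤ a (f (φ N)) := (f (φ N)).2
  have h3 : ‖A (v (f (φ N))) - A (v (f (φ (N + 1))))‖ ^ 2 =
      a (f (φ N)) ^ 2 + a (f (φ (N + 1))) ^ 2 := by
    rw [hav, hav, norm_sub_sq_real]
    simp [norm_smul, hv.1, inner_smul_left, inner_smul_right, hv.2 hne]
  simp only [Function.comp_apply, dist_eq_norm] at h1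
  have h4 : ‖A (v (f (φ N))) - A (v (f (φ (N + 1))))‖ ^ 2 < ε ^ 2 :=
    pow_lt_pow_left₀ h1 (norm_nonneg _) two_ne_zero
  nlinarith [sq_nonneg (a (f (φ (N + 1))))]

/-- Orthonormal bases of the finite-dimensional eigenspaces are glued together. Eigenvalues
accumulate only at `0`, so their inverses have finite sublevel sets and can be listed increasingly;
infinite dimension makes the index set `ℕ`. -/
theorem exists_hilbertBasis_eigenvectors (hH : ¬ FiniteDimensional ℝ H) {A : H →L[ℝ] H}
    (hA : IsCompactOperator A) (hsymm : (A : H →ₗ[ℝ] H).IsSymmetric)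
    (hinj : ∀ v, A v = 0 → v = 0) (hpos : ∀ v, 0 ≤ inner ℝ v (A v)) :
    ∃ (lam : ℕ → ℝ) (φ : HilbertBasis ℕ ℝ H), (∀ j, 0 < lam j) ∧ Monotone lam ∧
      Tendsto lam atTop atTop ∧ ∀ j, A (φ j) = (lam j)⁻¹ • φ j := by
  classical
  let T : Module.End ℝ H := (A : H →ₗ[ℝ] H)
  have hfd : ∀ a : T.Eigenvalues, FiniteDimensional ℝ (T.eigenspace a) := fun a => by
    refine ContinuousLinearMap.finite_dimensional_eigenspace hA a fun h0 => ?_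
    obtain ⟨v, hv, hv0⟩ := Module.End.HasEigenvalue.exists_hasEigenvector a.2
    rw [Module.End.mem_eigenspace_iff] at hv
    exact hv0 (hinj v (hv.trans ((congrArg (· • v) h0).trans (zero_smul ℝ v))))
  let ι := Σ a : T.Eigenvalues, Fin (Module.finrank ℝ (T.eigenspace a))
  let b : ∀ a : T.Eigenvalues, OrthonormalBasis _ ℝ (T.eigenspace (a : ℝ)) :=
    fun a => stdOrthonormalBasis ℝ (T.eigenspace (a : ℝ))
  let v : ι → H := fun i => (b i.1 i.2 : H)
  have hv : Orthonormal ℝ v :=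
    (hsymm.orthogonalFamily_eigenspaces').orthonormal_sigma_orthonormal
      (v_family := fun a => b a) fun a => (b a).orthonormal
  have hav : ∀ i, A (v i) = (i.1 : ℝ) • v i := fun i =>
    Module.End.mem_eigenspace_iff.1 (b i.1 i.2).2
  have hapos : ∀ i : ι, 0 < (i.1 : ℝ) := fun i => by
    have h1 := hpos (v i)
    rw [hav, inner_smul_right, real_inner_self_eq_norm_sq, hv.1] at h1
    have h2 : (i.1 : ℝ) ≠ 0 := fun h0 => by
      have := hinj (v i) (by rw [hav, h0, zero_smul])
      simpa [this] using hv.1 i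
    have h3 : 0 ≤ (i.1 : ℝ) := by simpa using h1
    exact lt_of_le_of_ne h3 h2.symm
  have hspan : (Submodule.span ℝ (range v))ᗮ = ⊥ := by
    rw [eq_bot_iff, ← ContinuousLinearMap.orthogonalComplement_iSup_eigenspaces_eq_bot hA hsymm]
    refine Submodule.orthogonal_le (iSup_le fun a => ?_)
    by_cases ha : T.HasEigenvalue a
    · let a' : T.Eigenvalues := ⟨a, ha⟩
      intro x hx
      have h1 := (b a').sum_repr ⟨x, hx⟩
      have h2 : x = ∑ i, (b a').repr ⟨x, hx⟩ i • v ⟨a', i⟩ := by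
        have := congrArg (Subtype.val) h1
        simpa [v] using this.symm
      rw [h2]
      exact Submodule.sum_mem _ fun i _ =>
        Submodule.smul_mem _ _ (Submodule.subset_span ⟨_, rfl⟩)
    · have : T.eigenspace a = ⊥ := by
        by_contra h
        exact ha (Module.End.hasEigenvalue_iff.2 h)
      exact (le_of_eq this).trans bot_le
  let β := HilbertBasis.mkOfOrthogonalEqBot hv hspan
  have hβ : ⇑β = v := HilbertBasis.coe_mkOfOrthogonalEqBot hv hspan
  have : Infinite ι := by
    by_contra hfin
    rw [not_infinite_iff_finite] at hfin
    have := Fintype.ofFinite ι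
    exact hH (Module.Finite.of_basis β.toOrthonormalBasis.toBasis)
  let l : ι → ℝ := fun i => (i.1 : ℝ)⁻¹
  -- Replacing `c` by `max c 1` keeps the threshold for the eigenvalues positive.
  have hl : ∀ c, {i | l i ≤ c}.Finite := fun c => by
    refine (finite_setOf_le_eigenvalue_of_isCompactOperator hA hv hav
      (ε := (max c 1)⁻¹) (by positivity)).subset fun i hi => ?_
    have h1 : (i.1 : ℝ)⁻¹ ≤ max c 1 := le_trans hi (le_max_left _ _)
    exact inv_le_of_inv_le₀ (hapos i) h1
  obtain ⟨e, he⟩ := exists_nat_equiv_monotone l hl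
  have hve : Orthonormal ℝ (v ∘ e) := hv.comp _ e.injective
  have hspan' : (Submodule.span ℝ (range (v ∘ e)))ᗮ = ⊥ := by
    rwa [e.surjective.range_comp]
  refine ⟨l ∘ e, HilbertBasis.mkOfOrthogonalEqBot hve hspan', fun j => inv_pos.2 (hapos _), he,
    ?_, fun j => ?_⟩
  · refine tendsto_atTop_atTop_of_monotone he fun c => ?_
    by_contra! h
    exact infinite_univ (((hl c).preimage e.injective.injOn).subset fun j _ => (h j).le)
  · rw [HilbertBasis.coe_mkOfOrthogonalEqBot]
    simp [hav, l]

theorem exists_pos_le_abs_sub {lam : ℕ → ℝ} (hlam : Tendsto lam atTop atTop) {μ : ℝ}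
    (hμ : μ ∉ range lam) : ∃ d > 0, ∀ j, d ≤ |lam j - μ| := by
  obtain ⟨N, hN⟩ := (hlam.eventually_ge_atTop (μ + 1)).exists_forall_of_atTop
  have hpos : ∀ j, 0 < |lam j - μ| := fun j => abs_pos.2 (sub_ne_zero.2 fun h => hμ ⟨j, h⟩)
  obtain ⟨d, hd, hd'⟩ : ∃ d > 0, ∀ j < N, d ≤ |lam j - μ| := by
    clear hN
    induction N with
    | zero => exact ⟨1, one_pos, by simp⟩
    | succ N ih =>
      obtain ⟨d, hd, h⟩ := ih
      refine ⟨min d |lam N - μ|, lt_min hd (hpos N), fun j hj => ?_⟩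
      rcases Nat.lt_succ_iff_lt_or_eq.1 hj with h1 | rfl
      · exact (min_le_left _ _).trans (h j h1)
      · exact min_le_right _ _
  refine ⟨min d 1, lt_min hd one_pos, fun j => ?_⟩
  rcases lt_or_ge j N with h | h
  · exact (min_le_left _ _).trans (hd' j h)
  · exact (min_le_right _ _).trans (le_trans (by linarith [hN j h]) (le_abs_self _))

omit [CompleteSpace H] in
theorem exists_diagonal_clm (φ : HilbertBasis ℕ ℝ H) (c : ℕ → ℝ) (M : ℝ) (hc : ∀ j, |c j| ≤ M) :
    ∃ Γ : H →L[ℝ] H, ∀ g, HasSum (fun j => (c j * inner ℝ g (φ j)) • φ j) (Γ g) := by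
  have hM : 0 ≤ M := (abs_nonneg _).trans (hc 0)
  have hbd : ∀ (g : H) (j : ℕ), |c j * inner ℝ g (φ j)| ^ 2 ≤ M ^ 2 * ‖φ.repr g j‖ ^ 2 :=
    fun g j => by
    rw [φ.repr_apply_apply, real_inner_comm, abs_mul, mul_pow, Real.norm_eq_abs]
    gcongr
    exact hc j
  have hs : ∀ g : H, HasSum (fun j => ‖φ.repr g j‖ ^ 2) (‖g‖ ^ 2) := fun g => by
    have := lp.hasSum_norm (p := 2) (by norm_num) (φ.repr g)
    simpa [φ.repr.norm_map] using this
  have hmem : ∀ g : H, Memℓp (fun j => c j * inner ℝ g (φ j)) 2 := fun g => by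
    refine memℓp_gen ?_
    refine Summable.of_nonneg_of_le (fun j => by positivity) (fun j => ?_)
      ((hs g).summable.mul_left (M ^ 2))
    simpa using hbd g j
  let D : H → H := fun g => φ.repr.symm ⟨_, hmem g⟩
  have hD : ∀ g, HasSum (fun j => (c j * inner ℝ g (φ j)) • φ j) (D g) := fun g =>
    φ.hasSum_repr_symm ⟨_, hmem g⟩
  have hDn : ∀ g, ‖D g‖ ≤ M * ‖g‖ := fun g => by
    refine (abs_le_of_sq_le_sq' ?_ (by positivity)).2
    have h1 := lp.hasSum_norm (p := 2) (by norm_num) (⟨_, hmem g⟩ : lp (fun _ : ℕ => ℝ) 2)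
    have h2 : ‖D g‖ = ‖(⟨_, hmem g⟩ : lp (fun _ : ℕ => ℝ) 2)‖ := φ.repr.symm.norm_map _
    rw [h2, mul_pow]
    refine hasSum_le (fun j => ?_) (by simpa using h1) ((hs g).mul_left (M ^ 2))
    simpa using hbd g j
  let Dl : H →ₗ[ℝ] H :=
    { toFun := D
      map_add' := fun x y => (hD (x + y)).unique (((hD x).add (hD y)).congr_fun fun j => by
        simp only [inner_add_left]; module)
      map_smul' := fun r x => (hD (r • x)).unique (((hD x).const_smul r).congr_fun fun j => by
        simp only [real_inner_smul_left]; module) }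
  exact ⟨Dl.mkContinuous M hDn, hD⟩

omit [CompleteSpace H] in
theorem clm_ext_hilbertBasis {F : Type*} [NormedAddCommGroup F] [NormedSpace ℝ F]
    (φ : HilbertBasis ℕ ℝ H) {S T : H →L[ℝ] F} (h : ∀ j, S (φ j) = T (φ j)) : S = T := by
  ext x
  have h1 := (φ.hasSum_repr x).mapL S
  have h2 := (φ.hasSum_repr x).mapL T
  simp only [map_smul, h] at h1 h2
  exact h1.unique h2

end Hilbert

/-- On `H` the operator `S = 1 + μΓ` inverts `1 - μA`. With `N = (1 - μR)⁻¹`, perturbation gives `S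
= N + μ S B j N`. The analogue `N' + μ j S B N'` makes sense on `W` because `B` lands in `H`;
composing it with `A'` gives `T`, since `A S = Γ`. -/
theorem exists_intertwined_resolvent {H W : Type*} [NormedAddCommGroup H] [NormedSpace ℝ H]
    [CompleteSpace H] [NormedAddCommGroup W] [NormedSpace ℝ W] [CompleteSpace W]
    (j : H →L[ℝ] W) (A R Γ : H →L[ℝ] H) (A' R' : W →L[ℝ] W) (B : W →L[ℝ] H) (μ : ℝ)
    (hA : A = R + B ∘L j) (hA' : A' = R' + j ∘L B) (hjR : j ∘L R = R' ∘L j)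
    (hR : ‖μ • R‖ < 1) (hR' : ‖μ • R'‖ < 1)
    (hΓ : Γ - μ • (Γ ∘L A) = A) (hΓ' : Γ - μ • (A ∘L Γ) = A) :
    ∃ T : W →L[ℝ] W, T ∘L j = j ∘L Γ := by
  obtain ⟨N, hN1, hN2⟩ : ∃ N : H →L[ℝ] H, N * (1 - μ • R) = 1 ∧ (1 - μ • R) * N = 1 :=
    ⟨_, (Units.oneSub (μ • R) hR).inv_mul, (Units.oneSub (μ • R) hR).mul_inv⟩
  obtain ⟨N', hN1', hN2'⟩ : ∃ N : W →L[ℝ] W, N * (1 - μ • R') = 1 ∧ (1 - μ • R') * N = 1 :=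
    ⟨_, (Units.oneSub (μ • R') hR').inv_mul, (Units.oneSub (μ • R') hR').mul_inv⟩
  have e1 : ∀ x, N (x - μ • R x) = x := fun x => by simpa using DFunLike.congr_fun hN1 x
  have e2 : ∀ x, N x - μ • R (N x) = x := fun x => by simpa using DFunLike.congr_fun hN2 x
  have e1' : ∀ x, N' (x - μ • R' x) = x := fun x => by simpa using DFunLike.congr_fun hN1' x
  have e3 : ∀ x, j (R x) = R' (j x) := fun x => DFunLike.congr_fun hjR x
  have e4 : ∀ x, Γ x - μ • Γ (A x) = A x := fun x => by simpa using DFunLike.congr_fun hΓ x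
  have e5 : ∀ x, Γ x - μ • A (Γ x) = A x := fun x => by simpa using DFunLike.congr_fun hΓ' x
  have e6 : ∀ x, A x = R x + B (j x) := fun x => by simp [hA]
  have e7 : ∀ x, A' x = R' x + j (B x) := fun x => by simp [hA']
  have hNj : ∀ x, N' (j x) = j (N x) := fun x => by
    have := e1' (j (N x))
    rwa [← e3, ← map_smul, ← map_sub, e2] at this
  have hAj : ∀ x, A' (j x) = j (A x) := fun x => by rw [e7, e6, map_add, e3]
  let S : H →L[ℝ] H := 1 + μ • Γ
  have hSx : ∀ x, S x = x + μ • Γ x := fun x => by simp [S]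
  have hS : ∀ x, S (x - μ • A x) = x := fun x => by
    calc S (x - μ • A x) = x - μ • A x + μ • (Γ x - μ • Γ (A x)) := by
          rw [hSx, map_sub, map_smul]
      _ = x := by rw [e4]; module
  -- The left inverse `S` is applied to `(1 - μA) N = 1 - μ B j N`.
  have hS2 : ∀ x, S x = N x + μ • S (B (j (N x))) := fun x => by
    have h1 := hS (N x)
    have h2 := e2 x
    have h3 : N x - μ • A (N x) = x - μ • B (j (N x)) := by
      calc N x - μ • A (N x) = (N x - μ • R (N x)) - μ • B (j (N x)) := by rw [e6]; module
        _ = _ := by rw [h2]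
    rw [h3, map_sub, map_smul] at h1
    exact sub_eq_iff_eq_add.1 h1
  refine ⟨A' ∘L (N' + μ • (j ∘L S ∘L B ∘L N')), ?_⟩
  ext x
  have h1 : (N' + μ • (j ∘L S ∘L B ∘L N')) (j x) = j (S x) := by
    change N' (j x) + μ • j (S (B (N' (j x)))) = j (S x)
    rw [hNj, hS2 x, map_add, map_smul]
  have h2 : A (S x) = Γ x := by
    rw [hSx, map_add, map_smul, ← eq_sub_iff_add_eq, ← e5 x]
  change A' ((N' + μ • (j ∘L S ∘L B ∘L N')) (j x)) = j (Γ x)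
  rw [h1, hAj, h2]

end GreenNotions

/-! ### Integral operators: Schur tests, Fubini, compactness -/

namespace GreenNotions

section Kernel

variable {α : Type*} [MeasurableSpace α] {ν ρ σ : Measure α} {p q : ℝ≥0∞}
  {K : α → α → ℝ}

/-- `T` is the integral operator with kernel `K` with respect to `ν`, the defining integrals being
absolutely convergent almost everywhere. -/
def IsKernelOp [Fact (1 ≤ p)] [Fact (1 ≤ q)] (ν : Measure α) (K : α → α → ℝ)
    (T : Lp ℝ p ρ →L[ℝ] Lp ℝ q σ) : Prop :=
  ∀ f, (∀ᵐ x ∂ν, Integrable (fun y => K x y * f y) ν) ∧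
    T f =ᵐ[ν] fun x => ∫ y, K x y * f y ∂ν

/-- The kernel `K` times a function of the second variable. -/
theorem aestronglyMeasurable_kernel_mul [SFinite ν]
    (hK : AEStronglyMeasurable (fun z : α × α => K z.1 z.2) (ν.prod ν)) {f : α → ℝ}
    (hf : AEStronglyMeasurable f ν) :
    AEStronglyMeasurable (fun z : α × α => K z.1 z.2 * f z.2) (ν.prod ν) :=
  hK.mul hf.comp_snd

/-- A norm bound for the integrals of `|K| |f|` yields both almost everywhere absolute convergence,
which linearity needs, and the operator bound. Keeping `ν`, `ρ`, `σ` separate covers `L²`, the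
weighted `L¹` and maps from one to the other. -/
theorem exists_isKernelOp [SFinite ν] [Fact (1 ≤ p)] [Fact (1 ≤ q)] (hq : q ≠ ⊤)
    (hK : AEStronglyMeasurable (fun z : α × α => K z.1 z.2) (ν.prod ν))
    (hνρ : ν ≪ ρ) (hνσ : ν ≪ σ) (hσν : σ ≪ ν) {M : ℝ≥0∞} (hM : M ≠ ⊤)
    (hb : ∀ f : α → ℝ, AEStronglyMeasurable f ν →
      eLpNorm (fun x => ∫⁻ y, ‖K x y‖ₑ * ‖f y‖ₑ ∂ν) q σ ≤ M * eLpNorm f p ρ) :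
    ∃ T : Lp ℝ p ρ →L[ℝ] Lp ℝ q σ, ‖T‖ ≤ M.toReal ∧ IsKernelOp ν K T := by
  have hq0 : q ≠ 0 := (zero_lt_one.trans_le (Fact.out : 1 ≤ q)).ne'
  have hfm : ∀ f : Lp ℝ p ρ, AEStronglyMeasurable f ν := fun f =>
    (Lp.aestronglyMeasurable f).mono_ac hνρ
  have hint : ∀ f : Lp ℝ p ρ, ∀ᵐ x ∂ν, Integrable (fun y => K x y * f y) ν := fun f => by
    have hm := aestronglyMeasurable_kernel_mul hK (hfm f)
    have h1 : eLpNorm (fun x => ∫⁻ y, ‖K x y‖ₑ * ‖f y‖ₑ ∂ν) q σ < ⊤ :=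
      (hb f (hfm f)).trans_lt (ENNReal.mul_lt_top hM.lt_top (Lp.eLpNorm_lt_top f))
    have h2 := (eLpNorm_lt_top_iff_lintegral_rpow_enorm_lt_top hq0 hq).1 h1
    have h3 : AEMeasurable (fun x => ∫⁻ y, ‖K x y‖ₑ * ‖f y‖ₑ ∂ν) ν := by
      have := hm.enorm.lintegral_prod_right'
      simpa only [enorm_mul] using this
    have h4 := ae_lt_top' ((h3.mono_ac hσν).enorm.pow_const q.toReal) h2.ne
    filter_upwards [hνσ.ae_le h4, hm.prodMk_left] with x hx hxm
    refine ⟨hxm, ?_⟩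
    rw [hasFiniteIntegral_iff_enorm]
    simp only [enorm_mul]
    by_contra h
    rw [not_lt, top_le_iff] at h
    rw [h] at hx
    simp [ENNReal.toReal_pos hq0 hq] at hx
  have hle : ∀ f : Lp ℝ p ρ, eLpNorm (fun x => ∫ y, K x y * f y ∂ν) q σ ≤ M * eLpNorm f p ρ :=
    fun f => by
    refine le_trans (eLpNorm_mono_enorm fun x => ?_) (hb f (hfm f))
    refine (enorm_integral_le_lintegral_enorm _).trans ?_
    simp only [enorm_mul, enorm_eq_self, le_refl]
  have hmem : ∀ f : Lp ℝ p ρ, MemLp (fun x => ∫ y, K x y * f y ∂ν) q σ := fun f =>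
    ⟨((aestronglyMeasurable_kernel_mul hK (hfm f)).integral_prod_right').mono_ac hσν,
      (hle f).trans_lt (ENNReal.mul_lt_top hM.lt_top (Lp.eLpNorm_lt_top f))⟩
  let T : Lp ℝ p ρ →ₗ[ℝ] Lp ℝ q σ :=
    { toFun := fun f => (hmem f).toLp _
      map_add' := fun f g => by
        rw [← MemLp.toLp_add, MemLp.toLp_eq_toLp_iff]
        refine hσν.ae_le ?_
        filter_upwards [hint f, hint g] with x hxf hxg
        rw [Pi.add_apply, ← integral_add hxf hxg]
        refine integral_congr_ae ?_
        filter_upwards [hνρ.ae_le (Lp.coeFn_add f g)] with y hy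
        rw [hy, Pi.add_apply, mul_add]
      map_smul' := fun c f => by
        rw [RingHom.id_apply, ← MemLp.toLp_const_smul, MemLp.toLp_eq_toLp_iff]
        refine Eventually.of_forall fun x => ?_
        simp only [Pi.smul_apply, smul_eq_mul]
        rw [← integral_const_mul]
        refine integral_congr_ae ?_
        filter_upwards [hνρ.ae_le (Lp.coeFn_smul c f)] with y hy
        rw [hy, Pi.smul_apply, smul_eq_mul]
        ring }
  have hT : ∀ f, ‖T f‖ ≤ M.toReal * ‖f‖ := fun f => by
    change ‖(hmem f).toLp _‖ ≤ _
    rw [Lp.norm_toLp, Lp.norm_def, ← ENNReal.toReal_mul]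
    exact ENNReal.toReal_mono (ENNReal.mul_ne_top hM (Lp.eLpNorm_ne_top f)) (hle f)
  exact ⟨T.mkContinuous _ hT, T.mkContinuous_norm_le ENNReal.toReal_nonneg hT,
    fun f => ⟨hint f, hνσ.ae_le (hmem f).coeFn_toLp⟩⟩

/-- Schur's test on a weighted `L¹` space. -/
theorem eLpNorm_one_lintegral_kernel_le [SFinite ν]
    (hK : AEStronglyMeasurable (fun z : α × α => K z.1 z.2) (ν.prod ν))
    {w : α → ℝ≥0∞} (hw : Measurable w) {M : ℝ≥0∞}
    (hM : ∀ᵐ y ∂ν, ∫⁻ x, ‖K x y‖ₑ * w x ∂ν ≤ M * w y) (f : α → ℝ)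
    (hf : AEStronglyMeasurable f ν) :
    eLpNorm (fun x => ∫⁻ y, ‖K x y‖ₑ * ‖f y‖ₑ ∂ν) 1 (ν.withDensity w) ≤
      M * eLpNorm f 1 (ν.withDensity w) := by
  have hm := (aestronglyMeasurable_kernel_mul hK hf).enorm
  simp only [enorm_mul] at hm
  rw [eLpNorm_one_eq_lintegral_enorm, eLpNorm_one_eq_lintegral_enorm]
  simp only [enorm_eq_self]
  rw [lintegral_withDensity_eq_lintegral_mul₀ hw.aemeasurable hm.lintegral_prod_right',
    lintegral_withDensity_eq_lintegral_mul₀ hw.aemeasurable hf.enorm]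
  calc ∫⁻ x, w x * ∫⁻ y, ‖K x y‖ₑ * ‖f y‖ₑ ∂ν ∂ν
      = ∫⁻ x, ∫⁻ y, w x * (‖K x y‖ₑ * ‖f y‖ₑ) ∂ν ∂ν := by
        refine lintegral_congr_ae ?_
        filter_upwards [hK.prodMk_left] with x hx
        exact (lintegral_const_mul'' _ (hx.enorm.mul hf.enorm)).symm
    _ = ∫⁻ y, ∫⁻ x, w x * (‖K x y‖ₑ * ‖f y‖ₑ) ∂ν ∂ν :=
        lintegral_lintegral_swap ((hw.comp measurable_fst).aemeasurable.mul hm)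
    _ ≤ ∫⁻ y, M * (w y * ‖f y‖ₑ) ∂ν := by
        refine lintegral_mono_ae ?_
        filter_upwards [hM, hK.prod_swap.prodMk_left] with y hy hym
        calc ∫⁻ x, w x * (‖K x y‖ₑ * ‖f y‖ₑ) ∂ν = ∫⁻ x, (‖K x y‖ₑ * w x) * ‖f y‖ₑ ∂ν := by
              refine lintegral_congr fun x => ?_
              ring
          _ = (∫⁻ x, ‖K x y‖ₑ * w x ∂ν) * ‖f y‖ₑ :=
              lintegral_mul_const'' _ (hym.enorm.mul hw.aemeasurable)
          _ ≤ _ := by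
              rw [← mul_assoc]
              gcongr
    _ = M * ∫⁻ y, w y * ‖f y‖ₑ ∂ν := lintegral_const_mul'' _ (hw.aemeasurable.mul hf.enorm)

/-- Cauchy-Schwarz for the factorization `k g = k^(1/2) (k g²)^(1/2)`. -/
theorem sq_lintegral_mul_le {k g : α → ℝ≥0∞} (hk : AEMeasurable k ν) (hg : AEMeasurable g ν) :
    (∫⁻ y, k y * g y ∂ν) ^ (2 : ℝ) ≤ (∫⁻ y, k y ∂ν) * ∫⁻ y, k y * g y ^ (2 : ℝ) ∂ν := by
  have h := ENNReal.lintegral_mul_norm_pow_le hk (hk.mul (hg.pow_const (2 : ℝ)))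
    (p := 1 / 2) (q := 1 / 2) (by norm_num) (by norm_num) (by norm_num)
  have h1 : ∀ y, k y ^ (1 / 2 : ℝ) * (k y * g y ^ (2 : ℝ)) ^ (1 / 2 : ℝ) = k y * g y := fun y => by
    rw [ENNReal.mul_rpow_of_nonneg _ _ (by norm_num), ← mul_assoc,
      ← ENNReal.rpow_add_of_nonneg _ _ (by norm_num) (by norm_num), ← ENNReal.rpow_mul]
    norm_num
  simp only [Pi.mul_apply, h1] at h
  rw [← ENNReal.mul_rpow_of_nonneg _ _ (by norm_num)] at h
  have h2 := ENNReal.rpow_le_rpow h (z := 2) (by norm_num)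
  rwa [← ENNReal.rpow_mul, one_div, inv_mul_cancel₀ (by norm_num), ENNReal.rpow_one] at h2

/-- Schur's test on `L²`. -/
theorem eLpNorm_two_lintegral_kernel_le [SFinite ν]
    (hK : AEStronglyMeasurable (fun z : α × α => K z.1 z.2) (ν.prod ν)) {M : ℝ≥0∞}
    (hM : ∀ᵐ x ∂ν, ∫⁻ y, ‖K x y‖ₑ ∂ν ≤ M) (hM' : ∀ᵐ y ∂ν, ∫⁻ x, ‖K x y‖ₑ ∂ν ≤ M) (f : α → ℝ)
    (hf : AEStronglyMeasurable f ν) :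
    eLpNorm (fun x => ∫⁻ y, ‖K x y‖ₑ * ‖f y‖ₑ ∂ν) 2 ν ≤ M * eLpNorm f 2 ν := by
  have hf2 := hf.enorm.pow_const (2 : ℝ)
  have hm : AEMeasurable (fun z : α × α => ‖K z.1 z.2‖ₑ * ‖f z.2‖ₑ ^ (2 : ℝ)) (ν.prod ν) :=
    hK.enorm.mul (hf.comp_snd.enorm.pow_const (2 : ℝ))
  rw [eLpNorm_eq_lintegral_rpow_enorm_toReal two_ne_zero ENNReal.ofNat_ne_top,
    eLpNorm_eq_lintegral_rpow_enorm_toReal two_ne_zero ENNReal.ofNat_ne_top]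
  simp only [enorm_eq_self, ENNReal.toReal_ofNat]
  have h : ∫⁻ x, (∫⁻ y, ‖K x y‖ₑ * ‖f y‖ₑ ∂ν) ^ (2 : ℝ) ∂ν ≤
      M ^ (2 : ℝ) * ∫⁻ y, ‖f y‖ₑ ^ (2 : ℝ) ∂ν := by
    calc ∫⁻ x, (∫⁻ y, ‖K x y‖ₑ * ‖f y‖ₑ ∂ν) ^ (2 : ℝ) ∂ν
        ≤ ∫⁻ x, M * ∫⁻ y, ‖K x y‖ₑ * ‖f y‖ₑ ^ (2 : ℝ) ∂ν ∂ν := by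
          refine lintegral_mono_ae ?_
          filter_upwards [hM, hK.prodMk_left] with x hx hxm
          refine (sq_lintegral_mul_le hxm.enorm hf.enorm).trans ?_
          gcongr
      _ = M * ∫⁻ x, ∫⁻ y, ‖K x y‖ₑ * ‖f y‖ₑ ^ (2 : ℝ) ∂ν ∂ν :=
          lintegral_const_mul'' _ hm.lintegral_prod_right'
      _ = M * ∫⁻ y, ∫⁻ x, ‖K x y‖ₑ * ‖f y‖ₑ ^ (2 : ℝ) ∂ν ∂ν := by
          rw [lintegral_lintegral_swap hm]
      _ ≤ M * ∫⁻ y, M * ‖f y‖ₑ ^ (2 : ℝ) ∂ν := by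
          refine mul_le_mul_right (lintegral_mono_ae ?_) _
          filter_upwards [hM', hK.prod_swap.prodMk_left] with y hy hym
          have hym' : AEMeasurable (fun x => ‖K x y‖ₑ) ν := hym.enorm
          rw [lintegral_mul_const'' _ hym']
          gcongr
      _ = M ^ (2 : ℝ) * ∫⁻ y, ‖f y‖ₑ ^ (2 : ℝ) ∂ν := by
          rw [lintegral_const_mul'' _ hf2, ← mul_assoc, ENNReal.rpow_two, sq]
  calc _ ≤ (M ^ (2 : ℝ) * ∫⁻ y, ‖f y‖ₑ ^ (2 : ℝ) ∂ν) ^ (1 / (2 : ℝ)) := by gcongr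
    _ = _ := by
      rw [ENNReal.mul_rpow_of_nonneg _ _ (by norm_num), ← ENNReal.rpow_mul]
      norm_num

/-- A kernel bounded by the weight maps the weighted `L¹` space to `L²`. -/
theorem eLpNorm_two_lintegral_kernel_le_one [SFinite ν] {w : α → ℝ≥0∞} (hw : Measurable w)
    {M : ℝ≥0∞} (hM : ∀ᵐ x ∂ν, ∀ᵐ y ∂ν, ‖K x y‖ₑ ≤ M * w y) (f : α → ℝ)
    (hf : AEStronglyMeasurable f ν) :
    eLpNorm (fun x => ∫⁻ y, ‖K x y‖ₑ * ‖f y‖ₑ ∂ν) 2 ν ≤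
      (ν univ ^ (1 / (2 : ℝ)) * M) * eLpNorm f 1 (ν.withDensity w) := by
  rw [eLpNorm_one_eq_lintegral_enorm,
    lintegral_withDensity_eq_lintegral_mul₀ hw.aemeasurable hf.enorm]
  have h : ∀ᵐ x ∂ν, ∫⁻ y, ‖K x y‖ₑ * ‖f y‖ₑ ∂ν ≤ M * ∫⁻ y, w y * ‖f y‖ₑ ∂ν := by
    filter_upwards [hM] with x hx
    refine le_trans (lintegral_mono_ae ?_)
      (lintegral_const_mul'' M (hw.aemeasurable.mul hf.enorm)).le
    filter_upwards [hx] with y hy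
    simp only [Pi.mul_apply]
    rw [← mul_assoc]
    gcongr
  rw [eLpNorm_eq_lintegral_rpow_enorm_toReal two_ne_zero ENNReal.ofNat_ne_top]
  simp only [enorm_eq_self, ENNReal.toReal_ofNat]
  calc _ ≤ (∫⁻ x, (M * ∫⁻ y, w y * ‖f y‖ₑ ∂ν) ^ (2 : ℝ) ∂ν) ^ (1 / (2 : ℝ)) := by
        gcongr ?_ ^ _
        refine lintegral_mono_ae ?_
        filter_upwards [h] with x hx
        gcongr
    _ = _ := by
      rw [lintegral_const, mul_comm, ENNReal.mul_rpow_of_nonneg _ _ (by norm_num),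
        ← ENNReal.rpow_mul]
      norm_num
      ring

/-- Fubini for `K(x,y) f(y) g(x)`. The right-hand side carries the transposed kernel, as no symmetry
is assumed here. -/
theorem integral_kernel_mul [SFinite ν]
    (hK : AEStronglyMeasurable (fun z : α × α => K z.1 z.2) (ν.prod ν)) {f g : α → ℝ}
    (hf : AEStronglyMeasurable f ν) (hg : AEStronglyMeasurable g ν)
    (hfin : ∫⁻ x, (∫⁻ y, ‖K x y‖ₑ * ‖f y‖ₑ ∂ν) * ‖g x‖ₑ ∂ν < ⊤) :
    Integrable (fun x => (∫ y, K x y * f y ∂ν) * g x) ν ∧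
    Integrable (fun y => f y * ∫ x, K x y * g x ∂ν) ν ∧
    ∫ x, (∫ y, K x y * f y ∂ν) * g x ∂ν = ∫ y, f y * ∫ x, K x y * g x ∂ν ∂ν := by
  have hm := aestronglyMeasurable_kernel_mul hK hf
  have hint : Integrable (fun z : α × α => K z.1 z.2 * f z.2 * g z.1) (ν.prod ν) := by
    refine ⟨hm.mul hg.comp_fst, ?_⟩
    rw [hasFiniteIntegral_iff_enorm]
    refine lt_of_eq_of_lt ((lintegral_prod _ (hm.mul hg.comp_fst).enorm).trans
      (lintegral_congr_ae ?_)) hfin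
    filter_upwards [hm.prodMk_left] with x hx
    have hx' := hx.enorm
    simp only [enorm_mul, Pi.mul_apply] at hx' ⊢
    rw [lintegral_mul_const'' _ hx']
  have e1 : (fun x => (∫ y, K x y * f y ∂ν) * g x) = fun x => ∫ y, K x y * f y * g x ∂ν := by
    ext x
    rw [integral_mul_const]
  have e2 : (fun y => f y * ∫ x, K x y * g x ∂ν) = fun y => ∫ x, K x y * f y * g x ∂ν := by
    ext y
    rw [← integral_const_mul]
    congr 1
    ext x
    ring
  rw [e1, e2]
  exact ⟨hint.integral_prod_left, hint.integral_prod_right,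
    (integral_prod _ hint).symm.trans (integral_prod_symm _ hint)⟩

/-- A bounded kernel on a finite measure space is Hilbert-Schmidt: `T (e i) x` is the inner product
of `e i` with `K x`, so Bessel bounds the sum of squares pointwise, and integration bounds `∑ ‖T (e
i)‖²`. -/
theorem IsKernelOp.isCompactOperator [IsFiniteMeasure ν]
    (hK : AEStronglyMeasurable (fun z : α × α => K z.1 z.2) (ν.prod ν))
    {b : ℝ} (hb : ∀ᵐ x ∂ν, ∀ᵐ y ∂ν, ‖K x y‖ ≤ b) {T : Lp ℝ 2 ν →L[ℝ] Lp ℝ 2 ν}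
    (hT : IsKernelOp ν K T) : IsCompactOperator T := by
  obtain ⟨_, e, -⟩ := exists_hilbertBasis ℝ (Lp ℝ 2 ν)
  -- An upper bound for the `L²` norm of any slice `K x` that is bounded by `|b|`.
  let c : ℝ := (measureUnivNNReal ν : ℝ) ^ (2 : ℝ≥0∞).toReal⁻¹ * |b|
  refine isCompactOperator_of_sum_norm_sq_le e T (ν.real univ * c ^ 2) fun F => ?_
  have h1 : ∀ f : Lp ℝ 2 ν, ‖f‖ ^ 2 = ∫ x, f x ^ 2 ∂ν := fun f => by
    rw [← real_inner_self_eq_norm_sq, L2.inner_def]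
    simp [sq]
  have h2 : ∀ f : Lp ℝ 2 ν, Integrable (fun x => f x ^ 2) ν := fun f => (Lp.memLp f).integrable_sq
  simp only [h1]
  rw [← integral_finsetSum _ fun i _ => h2 _]
  have h3 : ∀ᵐ x ∂ν, ∑ i ∈ F, T (e i) x ^ 2 ≤ c ^ 2 := by
    have h4 : ∀ᵐ x ∂ν, ∀ i ∈ F, T (e i) x = ∫ y, K x y * e i y ∂ν :=
      (ae_ball_iff F.countable_toSet).2 fun i _ => (hT (e i)).2
    filter_upwards [h4, hb, hK.prodMk_left] with x hx hbx hxm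
    have hbx' : ∀ᵐ y ∂ν, ‖K x y‖ ≤ |b| := by
      filter_upwards [hbx] with y hy using hy.trans (le_abs_self b)
    let k : Lp ℝ 2 ν := (MemLp.of_bound hxm |b| hbx').toLp _
    have hk : k =ᵐ[ν] K x := MemLp.coeFn_toLp _
    have hkn : ‖k‖ ≤ c := Lp.norm_le_of_ae_bound (abs_nonneg b) (by
      filter_upwards [hk, hbx'] with y h5 h6
      rwa [h5])
    have h7 : ∀ i ∈ F, T (e i) x = inner ℝ (e i) k := fun i hi => by
      rw [hx i hi, L2.inner_def]
      refine integral_congr_ae ?_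
      filter_upwards [hk] with y hy
      simp [hy]
    calc ∑ i ∈ F, T (e i) x ^ 2 = ∑ i ∈ F, ‖(inner ℝ (e i) k : ℝ)‖ ^ 2 :=
          Finset.sum_congr rfl fun i hi => by rw [h7 i hi, Real.norm_eq_abs, sq_abs]
      _ ≤ ‖k‖ ^ 2 := e.orthonormal.sum_inner_products_le k
      _ ≤ c ^ 2 := by gcongr
  calc _ ≤ ∫ _, c ^ 2 ∂ν :=
        integral_mono_ae (integrable_finsetSum _ fun i _ => h2 _) (integrable_const _) h3
    _ = _ := by simp

end Kernel

end GreenNotions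

/-! ### The weight, the Riesz kernel and pointwise bounds for Green's function -/

namespace GreenNotions

variable {n : ℕ} {Ω : Set (E n)} {s γ : ℝ}

/-- The density of `weightedMeasure`. -/
noncomputable def wdens (Ω : Set (E n)) (γ : ℝ) (x : E n) : ℝ≥0∞ := ENNReal.ofReal (bdist Ω x ^ γ)

theorem measurable_bdist (Ω : Set (E n)) : Measurable (bdist Ω) :=
  (Metric.continuous_infDist_pt _).measurable

theorem measurable_wdens (Ω : Set (E n)) (γ : ℝ) : Measurable (wdens Ω γ) :=
  ((measurable_bdist Ω).pow_const γ).ennreal_ofReal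

theorem bdist_nonneg (Ω : Set (E n)) (x : E n) : 0 ≤ bdist Ω x := Metric.infDist_nonneg

theorem bdist_le_add (Ω : Set (E n)) (x y : E n) : bdist Ω x ≤ bdist Ω y + ‖x - y‖ := by
  rw [← dist_eq_norm]
  exact Metric.infDist_le_infDist_add_dist

/-- `Metric.infDist` to the empty set is `0`, so the frontier must first be shown nonempty: `Ω` is
neither empty nor, being bounded, the whole space. -/
theorem bdist_pos [Nonempty (Fin n)] (hΩo : IsOpen Ω) (hΩb : Bornology.IsBounded Ω) {x : E n}
    (hx : x ∈ Ω) : 0 < bdist Ω x := by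
  have hne : (frontier Ω).Nonempty := nonempty_frontier_iff.2 ⟨⟨x, hx⟩, fun h =>
    NormedSpace.unbounded_univ ℝ (E n) (h ▸ hΩb)⟩
  refine (isClosed_frontier.notMem_iff_infDist_pos hne).1 fun h => ?_
  rw [hΩo.frontier_eq] at h
  exact h.2 hx

theorem exists_diameter_bound (hΩb : Bornology.IsBounded Ω) :
    ∃ D : ℝ, 0 < D ∧ (∀ x ∈ Ω, bdist Ω x ≤ D) ∧ ∀ x ∈ Ω, ∀ y ∈ Ω, ‖x - y‖ < D := by
  obtain ⟨C, hC⟩ := isBounded_iff_forall_norm_le.1 hΩb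
  refine ⟨bdist Ω 0 + 2 * |C| + 1, ?_, fun x hx => ?_, fun x hx y hy => ?_⟩
  · have := bdist_nonneg Ω 0
    positivity
  · have h1 := bdist_le_add Ω x 0
    have h2 := hC x hx
    rw [sub_zero] at h1
    have h3 := le_abs_self C
    have h4 := abs_nonneg C
    linarith
  · have h1 := norm_sub_le x y
    have h2 := hC x hx
    have h3 := hC y hy
    have h4 := le_abs_self C
    have h5 := bdist_nonneg Ω 0
    linarith

theorem isFiniteMeasure_restrict (hΩb : Bornology.IsBounded Ω) :
    IsFiniteMeasure ((volume : Measure (E n)).restrict Ω) :=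
  ⟨by rw [Measure.restrict_apply_univ]; exact hΩb.measure_lt_top⟩

theorem weightedMeasure_ac (Ω : Set (E n)) (γ : ℝ) :
    weightedMeasure Ω γ ≪ volume.restrict Ω := withDensity_absolutelyContinuous _ _

theorem ac_weightedMeasure [Nonempty (Fin n)] (hΩo : IsOpen Ω) (hΩb : Bornology.IsBounded Ω) :
    volume.restrict Ω ≪ weightedMeasure Ω γ := by
  refine withDensity_absolutelyContinuous' (measurable_wdens Ω γ).aemeasurable ?_
  filter_upwards [ae_restrict_mem hΩo.measurableSet] with x hx
  exact (ENNReal.ofReal_pos.2 (Real.rpow_pos_of_pos (bdist_pos hΩo hΩb hx) γ)).ne'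

theorem weightedMeasure_le (hΩo : IsOpen Ω) (hγ : 0 ≤ γ) {D : ℝ} (hD : ∀ x ∈ Ω, bdist Ω x ≤ D) :
    weightedMeasure Ω γ ≤ ENNReal.ofReal (D ^ γ) • volume.restrict Ω := by
  rw [← withDensity_const]
  refine withDensity_mono ?_
  filter_upwards [ae_restrict_mem hΩo.measurableSet] with x hx
  exact ENNReal.ofReal_le_ofReal (Real.rpow_le_rpow (bdist_nonneg Ω x) (hD x hx) hγ)

theorem exists_inclusion (hΩo : IsOpen Ω) (hΩb : Bornology.IsBounded Ω) (hγ : 0 ≤ γ) :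
    ∃ j : L2 Ω →L[ℝ] WL1 Ω γ, ∀ g, j g =ᵐ[weightedMeasure Ω γ] g := by
  obtain ⟨D, -, hD, -⟩ := exists_diameter_bound hΩb
  have := isFiniteMeasure_restrict hΩb
  have hle := weightedMeasure_le hΩo hγ hD
  let M : ℝ≥0∞ := ENNReal.ofReal (D ^ γ) *
    (volume.restrict Ω) univ ^ (1 / (1 : ℝ≥0∞).toReal - 1 / (2 : ℝ≥0∞).toReal)
  have hM : M ≠ ⊤ := ENNReal.mul_ne_top ENNReal.ofReal_ne_top
    (ENNReal.rpow_ne_top_of_nonneg (by norm_num) (measure_ne_top _ _))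
  have hb : ∀ g : L2 Ω, eLpNorm g 1 (weightedMeasure Ω γ) ≤
      M * eLpNorm g 2 (volume.restrict Ω) := fun g => by
    refine (eLpNorm_mono_measure _ hle).trans ?_
    rw [eLpNorm_smul_measure_of_ne_top ENNReal.one_ne_top]
    have h1 := eLpNorm_le_eLpNorm_mul_rpow_measure_univ (p := 1) (q := 2) (by norm_num)
      (Lp.aestronglyMeasurable g)
    rw [div_one, ENNReal.toReal_one, ENNReal.rpow_one, smul_eq_mul]
    calc _ ≤ _ := mul_le_mul_right h1 _
      _ = _ := by simp only [M, ENNReal.toReal_one]; ring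
  have hmem : ∀ g : L2 Ω, MemLp g 1 (weightedMeasure Ω γ) := fun g =>
    ⟨(Lp.aestronglyMeasurable g).mono_ac (weightedMeasure_ac Ω γ),
      (hb g).trans_lt (ENNReal.mul_lt_top hM.lt_top (Lp.eLpNorm_lt_top g))⟩
  let T : L2 Ω →ₗ[ℝ] WL1 Ω γ :=
    { toFun := fun g => (hmem g).toLp _
      map_add' := fun f g => by
        rw [← MemLp.toLp_add, MemLp.toLp_eq_toLp_iff]
        exact (weightedMeasure_ac Ω γ).ae_le (Lp.coeFn_add f g)
      map_smul' := fun c f => by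
        rw [RingHom.id_apply, ← MemLp.toLp_const_smul, MemLp.toLp_eq_toLp_iff]
        exact (weightedMeasure_ac Ω γ).ae_le (Lp.coeFn_smul c f) }
  refine ⟨T.mkContinuous M.toReal fun g => ?_, fun g => (hmem g).coeFn_toLp⟩
  change ‖(hmem g).toLp _‖ ≤ _
  rw [Lp.norm_toLp, Lp.norm_def, ← ENNReal.toReal_mul]
  exact ENNReal.toReal_mono (ENNReal.mul_ne_top hM (Lp.eLpNorm_ne_top g)) (hb g)

/-- Simple functions are dense in the weighted `L¹` and, `Ω` having finite measure, belong to `L²`.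
-/
theorem denseRange_inclusion (hΩb : Bornology.IsBounded Ω)
    {j : L2 Ω →L[ℝ] WL1 Ω γ} (hj : ∀ g, j g =ᵐ[weightedMeasure Ω γ] g) : DenseRange j := by
  have := isFiniteMeasure_restrict hΩb
  refine (Lp.simpleFunc.denseRange (μ := weightedMeasure Ω γ) (E := ℝ) ENNReal.one_ne_top).mono ?_
  rintro _ ⟨f, rfl⟩
  let f' := Lp.simpleFunc.toSimpleFunc f
  have hm : MemLp f' 2 (volume.restrict Ω) := f'.memLp_of_isFiniteMeasure _ _
  refine ⟨hm.toLp _, Lp.ext ?_⟩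
  filter_upwards [hj (hm.toLp _), (weightedMeasure_ac Ω γ).ae_le hm.coeFn_toLp,
    Lp.simpleFunc.toSimpleFunc_eq_toFun f] with x h1 h2 h3
  rw [h1, h2, h3]

/-- The mass of the Riesz kernel `|z|^(2s-n)` on the ball of radius `r`. -/
noncomputable def rieszMass (n : ℕ) (s r : ℝ) : ℝ≥0∞ :=
  ∫⁻ z in Metric.ball (0 : E n) r, ENNReal.ofReal (‖z‖ ^ (2 * s - n))

theorem rieszMass_ne_top (hn : 1 ≤ n) (hs : 0 < s) (r : ℝ) : rieszMass n s r ≠ ⊤ := by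
  have h : IntegrableOn (fun z : E n => ‖z‖ ^ (2 * s - n)) (Metric.ball 0 r) := by
    refine integrableOn_ball_of_norm_le_rpow (C := 1) (α := n - 2 * s) (by simpa using hn)
      (by simpa using hs) (Eventually.of_forall fun x => ?_)
      (measurable_norm.pow_const _).aestronglyMeasurable
    rw [neg_sub, one_mul, Real.norm_of_nonneg (by positivity)]
  have h1 := h.2
  rw [hasFiniteIntegral_iff_ofReal (Eventually.of_forall fun x => by positivity)] at h1
  exact h1.ne

/-- Absolute continuity of the integral over the unit ball; this is what makes the near part of the
kernel small. -/
theorem exists_rieszMass_lt (hn : 1 ≤ n) (hs : 0 < s) {η : ℝ≥0∞} (hη : η ≠ 0) :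
    ∃ r : ℝ, 0 < r ∧ rieszMass n s r < η := by
  have : Nonempty (Fin n) := ⟨⟨0, hn⟩⟩
  obtain ⟨d, hd, h⟩ := exists_pos_setLIntegral_lt_of_measure_lt (rieszMass_ne_top hn hs 1) hη
  have hlim : Tendsto (fun r : ℝ => ENNReal.ofReal (r ^ n) * volume (Metric.ball (0 : E n) 1))
      (𝓝 0) (𝓝 0) := by
    have h1 : Tendsto (fun r : ℝ => ENNReal.ofReal (r ^ n)) (𝓝 0) (𝓝 0) := by
      have : Continuous fun r : ℝ => ENNReal.ofReal (r ^ n) :=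
        ENNReal.continuous_ofReal.comp (continuous_pow n)
      simpa [zero_pow (by omega : n ≠ 0)] using this.tendsto 0
    have h2 := ENNReal.Tendsto.mul_const (b := volume (Metric.ball (0 : E n) 1)) h1
      (Or.inr Metric.isBounded_ball.measure_lt_top.ne)
    simpa using h2
  obtain ⟨t, ht, ht'⟩ := Metric.eventually_nhds_iff.1 (hlim.eventually (gt_mem_nhds hd))
  -- The cap `1` keeps the ball inside the unit ball, where absolute continuity was invoked.
  let r := min (t / 2) 1
  have hr : 0 < r := lt_min (by positivity) one_pos
  refine ⟨r, hr, ?_⟩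
  have h3 : volume (Metric.ball (0 : E n) r) < d := by
    rw [Measure.addHaar_ball _ _ hr.le]
    simp only [finrank_euclideanSpace, Fintype.card_fin]
    refine ht' ?_
    rw [Real.dist_eq, sub_zero, abs_of_pos hr]
    exact (min_le_left _ _).trans_lt (by linarith)
  have h4 := h (Metric.ball 0 r) ((Measure.restrict_apply_le _ _).trans_lt h3)
  rwa [Measure.restrict_restrict Metric.isOpen_ball.measurableSet,
    inter_eq_left.2 (Metric.ball_subset_ball (min_le_right _ _))] at h4

/-- The kernel `K` is bounded by the Riesz kernel, also after conjugation with the weight, and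
vanishes at distance at least `r` from the diagonal. -/
structure KernelBound (Ω : Set (E n)) (s γ C r : ℝ) (K : E n → E n → ℝ) : Prop where
  meas : AEStronglyMeasurable (fun p : E n × E n => K p.1 p.2)
    ((volume.restrict Ω).prod (volume.restrict Ω))
  bound : ∀ x ∈ Ω, ∀ y ∈ Ω, x ≠ y → |K x y| ≤ C * ‖x - y‖ ^ (2 * s - n)
  weighted : ∀ x ∈ Ω, ∀ y ∈ Ω, x ≠ y →
    |K x y| * bdist Ω x ^ γ ≤ C * ‖x - y‖ ^ (2 * s - n) * bdist Ω y ^ γ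
  supp : ∀ x ∈ Ω, ∀ y ∈ Ω, r ≤ ‖x - y‖ → K x y = 0

theorem ae_ne_mem [Nonempty (Fin n)] (hΩo : IsOpen Ω) (x : E n) :
    ∀ᵐ y ∂(volume.restrict Ω), y ∈ Ω ∧ y ≠ x := by
  filter_upwards [ae_restrict_mem hΩo.measurableSet,
    ae_restrict_of_ae (Measure.ae_ne volume x)] with y h1 h2 using ⟨h1, h2⟩

theorem lintegral_riesz_le (Ω : Set (E n)) (s r : ℝ) (x : E n) :
    ∫⁻ y in Ω, (Metric.ball (0 : E n) r).indicator
      (fun z => ENNReal.ofReal (‖z‖ ^ (2 * s - n))) (x - y) ≤ rieszMass n s r := by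
  refine (lintegral_mono' Measure.restrict_le_self le_rfl).trans ?_
  rw [lintegral_sub_left_eq_self (fun z => (Metric.ball (0 : E n) r).indicator
      (fun z => ENNReal.ofReal (‖z‖ ^ (2 * s - n))) z),
    lintegral_indicator Metric.isOpen_ball.measurableSet]
  rfl

namespace KernelBound

variable {C r : ℝ} {K : E n → E n → ℝ}

theorem enorm_mul_le (h : KernelBound Ω s γ C r K) (hC : 0 ≤ C) {x y : E n} (hx : x ∈ Ω)
    (hy : y ∈ Ω) (hxy : x ≠ y) :
    ‖K x y‖ₑ ≤ ENNReal.ofReal C * (Metric.ball (0 : E n) r).indicator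
      (fun z => ENNReal.ofReal (‖z‖ ^ (2 * s - n))) (x - y) := by
  by_cases hr : ‖x - y‖ < r
  · rw [indicator_of_mem (by simpa using hr), ← ENNReal.ofReal_mul hC, Real.enorm_eq_ofReal_abs]
    exact ENNReal.ofReal_le_ofReal (h.bound x hx y hy hxy)
  · simp [h.supp x hx y hy (not_lt.1 hr)]

theorem enorm_mul_wdens_le (h : KernelBound Ω s γ C r K) (hC : 0 ≤ C) {x y : E n} (hx : x ∈ Ω)
    (hy : y ∈ Ω) (hxy : x ≠ y) :
    ‖K x y‖ₑ * wdens Ω γ x ≤ (ENNReal.ofReal C * wdens Ω γ y) *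
      (Metric.ball (0 : E n) r).indicator
        (fun z => ENNReal.ofReal (‖z‖ ^ (2 * s - n))) (y - x) := by
  by_cases hr : ‖x - y‖ < r
  · rw [indicator_of_mem (by rw [mem_ball_zero_iff, norm_sub_rev]; exact hr),
      Real.enorm_eq_ofReal_abs, wdens, wdens, ← ENNReal.ofReal_mul (abs_nonneg _),
      ← ENNReal.ofReal_mul hC, ← ENNReal.ofReal_mul (mul_nonneg hC
        (Real.rpow_nonneg (bdist_nonneg Ω y) γ)), norm_sub_rev y x]
    exact ENNReal.ofReal_le_ofReal ((h.weighted x hx y hy hxy).trans (le_of_eq (by ring)))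
  · simp [h.supp x hx y hy (not_lt.1 hr)]

theorem eLpNorm_two_le (hn : 1 ≤ n) (hΩo : IsOpen Ω) (hΩb : Bornology.IsBounded Ω)
    (hC : 0 ≤ C) (h : KernelBound Ω s γ C r K) (f : E n → ℝ)
    (hf : AEStronglyMeasurable f (volume.restrict Ω)) :
    eLpNorm (fun x => ∫⁻ y in Ω, ‖K x y‖ₑ * ‖f y‖ₑ) 2 (volume.restrict Ω) ≤
      (ENNReal.ofReal C * rieszMass n s r) * eLpNorm f 2 (volume.restrict Ω) := by
  have : Nonempty (Fin n) := ⟨⟨0, hn⟩⟩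
  have := isFiniteMeasure_restrict hΩb
  have h1 : ∀ x ∈ Ω, ∫⁻ y in Ω, ‖K x y‖ₑ ≤ ENNReal.ofReal C * rieszMass n s r := fun x hx => by
    refine (lintegral_mono_ae ?_).trans ((lintegral_const_mul' _ _ ENNReal.ofReal_ne_top).le.trans
      (mul_le_mul_right (lintegral_riesz_le Ω s r x) _))
    filter_upwards [ae_ne_mem hΩo x] with y hy
    exact h.enorm_mul_le hC hx hy.1 hy.2.symm
  have h2 : ∀ y ∈ Ω, ∫⁻ x in Ω, ‖K x y‖ₑ ≤ ENNReal.ofReal C * rieszMass n s r := fun y hy => by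
    refine (lintegral_mono_ae ?_).trans ((lintegral_const_mul' _ _ ENNReal.ofReal_ne_top).le.trans
      (mul_le_mul_right (lintegral_riesz_le Ω s r y) _))
    filter_upwards [ae_ne_mem hΩo y] with x hx
    refine (h.enorm_mul_le hC hx.1 hy hx.2).trans (le_of_eq ?_)
    simp only [indicator, mem_ball_zero_iff, norm_sub_rev x y]
  refine eLpNorm_two_lintegral_kernel_le h.meas ?_ ?_ f hf
  · filter_upwards [ae_restrict_mem hΩo.measurableSet] with x hx using h1 x hx
  · filter_upwards [ae_restrict_mem hΩo.measurableSet] with x hx using h2 x hx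

theorem exists_L2 (hn : 1 ≤ n) (hs : 0 < s) (hΩo : IsOpen Ω) (hΩb : Bornology.IsBounded Ω)
    (hC : 0 ≤ C) (h : KernelBound Ω s γ C r K) :
    ∃ T : L2 Ω →L[ℝ] L2 Ω, ‖T‖ ≤ (ENNReal.ofReal C * rieszMass n s r).toReal ∧
      IsKernelOp (volume.restrict Ω) K T := by
  have := isFiniteMeasure_restrict hΩb
  exact exists_isKernelOp ENNReal.ofNat_ne_top h.meas Measure.AbsolutelyContinuous.rfl
    Measure.AbsolutelyContinuous.rfl Measure.AbsolutelyContinuous.rfl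
    (ENNReal.mul_ne_top ENNReal.ofReal_ne_top (rieszMass_ne_top hn hs r))
    (h.eLpNorm_two_le hn hΩo hΩb hC)

theorem ae_lintegral_wdens_le (hn : 1 ≤ n) (hΩo : IsOpen Ω)
    (hC : 0 ≤ C) (h : KernelBound Ω s γ C r K) :
    ∀ᵐ y ∂(volume.restrict Ω), ∫⁻ x in Ω, ‖K x y‖ₑ * wdens Ω γ x ≤
      (ENNReal.ofReal C * rieszMass n s r) * wdens Ω γ y := by
  have : Nonempty (Fin n) := ⟨⟨0, hn⟩⟩
  filter_upwards [ae_restrict_mem hΩo.measurableSet] with y hy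
  refine (lintegral_mono_ae (g := fun x => (ENNReal.ofReal C * wdens Ω γ y) *
      (Metric.ball (0 : E n) r).indicator (fun z => ENNReal.ofReal (‖z‖ ^ (2 * s - n))) (y - x))
    ?_).trans ((lintegral_const_mul' _ _
      (ENNReal.mul_ne_top ENNReal.ofReal_ne_top ENNReal.ofReal_ne_top)).le.trans ?_)
  · filter_upwards [ae_ne_mem hΩo y] with x hx
    exact h.enorm_mul_wdens_le hC hx.1 hy hx.2
  · calc _ ≤ (ENNReal.ofReal C * wdens Ω γ y) * rieszMass n s r :=
          mul_le_mul_right (lintegral_riesz_le Ω s r y) _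
      _ = _ := by ring

theorem exists_WL1 (hn : 1 ≤ n) (hs : 0 < s) (hΩo : IsOpen Ω) (hΩb : Bornology.IsBounded Ω)
    (hC : 0 ≤ C) (h : KernelBound Ω s γ C r K) :
    ∃ T : WL1 Ω γ →L[ℝ] WL1 Ω γ, ‖T‖ ≤ (ENNReal.ofReal C * rieszMass n s r).toReal ∧
      IsKernelOp (volume.restrict Ω) K T := by
  have : Nonempty (Fin n) := ⟨⟨0, hn⟩⟩
  have := isFiniteMeasure_restrict hΩb
  exact exists_isKernelOp ENNReal.one_ne_top h.meas (ac_weightedMeasure hΩo hΩb)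
    (ac_weightedMeasure hΩo hΩb) (weightedMeasure_ac Ω γ)
    (ENNReal.mul_ne_top ENNReal.ofReal_ne_top (rieszMass_ne_top hn hs r))
    (eLpNorm_one_lintegral_kernel_le h.meas (measurable_wdens Ω γ)
      (h.ae_lintegral_wdens_le hn hΩo hC))

/-- The part of the kernel at distance less than `ε` from the diagonal. -/
theorem near (h : KernelBound Ω s γ C r K) (hC : 0 ≤ C) (ε : ℝ) :
    KernelBound Ω s γ C ε (fun x y => if ‖x - y‖ < ε then K x y else 0) where
  meas := by
    have hS : MeasurableSet {p : E n × E n | ‖p.1 - p.2‖ < ε} :=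
      measurableSet_lt (by fun_prop) measurable_const
    refine (h.meas.indicator hS).congr (Eventually.of_forall fun p => ?_)
    simp [indicator]
  bound x hx y hy hxy := by
    split_ifs
    · exact h.bound x hx y hy hxy
    · rw [abs_zero]
      positivity
  weighted x hx y hy hxy := by
    split_ifs
    · exact h.weighted x hx y hy hxy
    · rw [abs_zero, zero_mul]
      have := bdist_nonneg Ω y
      positivity
  supp x hx y hy hxy := by
    simp [not_lt.2 hxy]

end KernelBound

theorem refKernel_nonneg (Ω : Set (E n)) (s γ : ℝ) (x y : E n) : 0 ≤ refKernel Ω s γ x y := by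
  have h1 := bdist_nonneg Ω x
  have h2 := bdist_nonneg Ω y
  unfold refKernel
  positivity

theorem refKernel_le (Ω : Set (E n)) (s γ : ℝ) (x y : E n) :
    refKernel Ω s γ x y ≤ ‖x - y‖ ^ (2 * s - n) * min (bdist Ω y ^ γ / ‖x - y‖ ^ γ) 1 := by
  have h1 := bdist_nonneg Ω x
  have h2 := bdist_nonneg Ω y
  have h3 : 1 / ‖x - y‖ ^ ((n : ℝ) - 2 * s) = ‖x - y‖ ^ (2 * s - n) := by
    rw [← neg_sub (n : ℝ), Real.rpow_neg (norm_nonneg _), one_div]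
  unfold refKernel
  rw [h3]
  gcongr
  exact mul_le_of_le_one_right (by positivity) (min_le_right _ _)

theorem refKernel_le_riesz (Ω : Set (E n)) (s γ : ℝ) (x y : E n) :
    refKernel Ω s γ x y ≤ ‖x - y‖ ^ (2 * s - n) :=
  (refKernel_le Ω s γ x y).trans (mul_le_of_le_one_right (by positivity) (min_le_right _ _))

theorem refKernel_mul_le_far (Ω : Set (E n)) (s γ : ℝ) {x y : E n} (hxy : x ≠ y) :
    refKernel Ω s γ x y * ‖x - y‖ ^ γ ≤ ‖x - y‖ ^ (2 * s - n) * bdist Ω y ^ γ := by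
  have ht : 0 < ‖x - y‖ := norm_pos_iff.2 (sub_ne_zero.2 hxy)
  have htγ : 0 < ‖x - y‖ ^ γ := Real.rpow_pos_of_pos ht γ
  calc _ ≤ (‖x - y‖ ^ (2 * s - n) * (bdist Ω y ^ γ / ‖x - y‖ ^ γ)) * ‖x - y‖ ^ γ := by
        gcongr
        exact (refKernel_le Ω s γ x y).trans
          (mul_le_mul_of_nonneg_left (min_le_left _ _) (by positivity))
    _ = _ := by field_simp

/-- The distance is 1-Lipschitz and `t ↦ t^γ` is subadditive for `γ ≤ 1`, so `δ(x)^γ ≤ δ(y)^γ +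
|x-y|^γ`. The Riesz bound handles the first summand; the boundary factor of the kernel at `y`
handles the second. -/
theorem refKernel_mul_bdist_le (hγ : γ ∈ Ioc (0 : ℝ) 1) (Ω : Set (E n)) (s : ℝ) {x y : E n}
    (hxy : x ≠ y) :
    refKernel Ω s γ x y * bdist Ω x ^ γ ≤ 2 * ‖x - y‖ ^ (2 * s - n) * bdist Ω y ^ γ := by
  have ht : 0 < ‖x - y‖ := norm_pos_iff.2 (sub_ne_zero.2 hxy)
  have h1 := bdist_nonneg Ω x
  have h2 := bdist_nonneg Ω y
  have h3 : bdist Ω x ^ γ ≤ bdist Ω y ^ γ + ‖x - y‖ ^ γ :=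
    (Real.rpow_le_rpow h1 (bdist_le_add Ω x y) hγ.1.le).trans
      (Real.rpow_add_le_add_rpow h2 ht.le hγ.1.le hγ.2)
  calc _ ≤ refKernel Ω s γ x y * (bdist Ω y ^ γ + ‖x - y‖ ^ γ) :=
        mul_le_mul_of_nonneg_left h3 (refKernel_nonneg Ω s γ x y)
    _ = refKernel Ω s γ x y * bdist Ω y ^ γ + refKernel Ω s γ x y * ‖x - y‖ ^ γ := mul_add _ _ _
    _ ≤ ‖x - y‖ ^ (2 * s - n) * bdist Ω y ^ γ + ‖x - y‖ ^ (2 * s - n) * bdist Ω y ^ γ :=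
        add_le_add (mul_le_mul_of_nonneg_right (refKernel_le_riesz Ω s γ x y) (by positivity))
          (refKernel_mul_le_far Ω s γ hxy)
    _ = _ := by ring

/-- Both endpoints appear because the exponent used later, `2s - n`, can have either sign. -/
theorem rpow_le_rpow_add_rpow {ε t D : ℝ} (hε : 0 < ε) (h1 : ε ≤ t) (h2 : t ≤ D) (p : ℝ) :
    t ^ p ≤ ε ^ p + D ^ p := by
  have ht : 0 < t := hε.trans_le h1
  have hD : 0 < D := ht.trans_le h2
  rcases le_total 0 p with hp | hp
  · have := Real.rpow_le_rpow ht.le h2 hp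
    have := Real.rpow_nonneg hε.le p
    linarith
  · have := Real.rpow_le_rpow_of_nonpos hε h1 hp
    have := Real.rpow_nonneg hD.le p
    linarith

section Green

variable {L : L2 Ω →ₗ.[ℝ] L2 Ω} {G : E n → E n → ℝ}

theorem K1.abs_le (hK : K1 Ω s γ L G) : ∃ C : ℝ, 0 < C ∧ ∀ x ∈ Ω, ∀ y ∈ Ω, x ≠ y →
    |G x y| ≤ C * refKernel Ω s γ x y := by
  obtain ⟨C, hC, h⟩ := hK.comparable
  exact ⟨C, hC, fun x hx y hy hxy => by
    rw [abs_of_pos (hK.pos x hx y hy hxy)]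
    exact (h x hx y hy hxy).2⟩

theorem K1.exists_kernelBound (hγ : γ ∈ Ioc (0 : ℝ) 1) (hΩb : Bornology.IsBounded Ω)
    (hK : K1 Ω s γ L G) : ∃ C r : ℝ, 0 ≤ C ∧ KernelBound Ω s γ C r G := by
  obtain ⟨C, hC, h⟩ := hK.abs_le
  obtain ⟨D, -, -, hD⟩ := exists_diameter_bound hΩb
  -- The factor `2` comes from the weighted bound. Distances in `Ω` are strictly less than `D`, so
  -- the support condition is vacuous.
  refine ⟨2 * C, D, by positivity, hK.measurable, fun x hx y hy hxy => ?_,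
    fun x hx y hy hxy => ?_, fun x hx y hy hxy => absurd (hD x hx y hy) (not_lt.2 hxy)⟩
  · calc |G x y| ≤ C * refKernel Ω s γ x y := h x hx y hy hxy
      _ ≤ (2 * C) * ‖x - y‖ ^ (2 * s - n) := by
        have := refKernel_nonneg Ω s γ x y
        exact mul_le_mul (by linarith) (refKernel_le_riesz Ω s γ x y) this (by positivity)
  · have := bdist_nonneg Ω x
    calc |G x y| * bdist Ω x ^ γ ≤ (C * refKernel Ω s γ x y) * bdist Ω x ^ γ := by
          gcongr
          exact h x hx y hy hxy
      _ = C * (refKernel Ω s γ x y * bdist Ω x ^ γ) := by ring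
      _ ≤ C * (2 * ‖x - y‖ ^ (2 * s - n) * bdist Ω y ^ γ) :=
          mul_le_mul_of_nonneg_left (refKernel_mul_bdist_le hγ Ω s hxy) hC.le
      _ = _ := by ring

/-- The bound with `δ(y)^γ` sends the weighted `L¹` into `L²`; the uniform bound gives compactness
on `L²`. -/
theorem K1.exists_far_bound (hΩb : Bornology.IsBounded Ω) (hγ : 0 < γ)
    (hK : K1 Ω s γ L G) {ε : ℝ} (hε : 0 < ε) : ∃ M : ℝ, 0 ≤ M ∧ ∀ x ∈ Ω, ∀ y ∈ Ω,
      ε ≤ ‖x - y‖ → |G x y| ≤ M * bdist Ω y ^ γ ∧ |G x y| ≤ M := by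
  obtain ⟨C, hC, h⟩ := hK.abs_le
  obtain ⟨D, hD0, -, hD⟩ := exists_diameter_bound hΩb
  let P := ε ^ (2 * s - n) + D ^ (2 * s - n)
  refine ⟨C * P / ε ^ γ + C * P, by positivity, fun x hx y hy hxy => ?_⟩
  have hne : x ≠ y := by
    rintro rfl
    rw [sub_self, norm_zero] at hxy
    linarith
  have hP : ‖x - y‖ ^ (2 * s - n) ≤ P := rpow_le_rpow_add_rpow hε hxy (hD x hx y hy).le _
  have hb := bdist_nonneg Ω y
  have hG := h x hx y hy hne
  have hk := refKernel_nonneg Ω s γ x y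
  have h1 : |G x y| ≤ C * P := hG.trans
    (mul_le_mul_of_nonneg_left ((refKernel_le_riesz Ω s γ x y).trans hP) hC.le)
  have h2 : |G x y| * ε ^ γ ≤ C * P * bdist Ω y ^ γ :=
    calc |G x y| * ε ^ γ ≤ (C * refKernel Ω s γ x y) * ‖x - y‖ ^ γ := by gcongr
      _ = C * (refKernel Ω s γ x y * ‖x - y‖ ^ γ) := by ring
      _ ≤ C * (‖x - y‖ ^ (2 * s - n) * bdist Ω y ^ γ) :=
          mul_le_mul_of_nonneg_left (refKernel_mul_le_far Ω s γ hne) hC.le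
      _ ≤ C * (P * bdist Ω y ^ γ) := by gcongr
      _ = _ := by ring
  constructor
  · calc |G x y| ≤ C * P * bdist Ω y ^ γ / ε ^ γ := (le_div_iff₀ (by positivity)).2 h2
      _ = C * P / ε ^ γ * bdist Ω y ^ γ := by ring
      _ ≤ _ := by
        gcongr
        exact le_add_of_nonneg_right (by positivity)
  · exact h1.trans (le_add_of_nonneg_left (by positivity))

end Green

end GreenNotions

/-! ### Green operators on both spaces and their near-far splitting -/

namespace GreenNotions

section KernelAlgebra

variable {α : Type*} [MeasurableSpace α] {ν ρ σ ρ' σ' ρ'' σ'' : Measure α}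
  {p q p' q' p'' q'' : ℝ≥0∞} [Fact (1 ≤ p)] [Fact (1 ≤ q)] [Fact (1 ≤ p')] [Fact (1 ≤ q')]
  [Fact (1 ≤ p'')] [Fact (1 ≤ q'')] {K K' K'' : α → α → ℝ}
  {T : Lp ℝ p ρ →L[ℝ] Lp ℝ q σ} {T' : Lp ℝ p' ρ' →L[ℝ] Lp ℝ q' σ'}
  {T'' : Lp ℝ p'' ρ'' →L[ℝ] Lp ℝ q'' σ''}

theorem IsKernelOp.ae_eq (hT : IsKernelOp ν K T) (hT' : IsKernelOp ν K T') {f : Lp ℝ p ρ}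
    {f' : Lp ℝ p' ρ'} (h : f =ᵐ[ν] f') : T f =ᵐ[ν] T' f' := by
  filter_upwards [(hT f).2, (hT' f').2] with x h1 h2
  rw [h1, h2]
  refine integral_congr_ae ?_
  filter_upwards [h] with y hy
  rw [hy]

theorem IsKernelOp.ae_eq_add (hT : IsKernelOp ν K T) (hT' : IsKernelOp ν K' T')
    (hT'' : IsKernelOp ν K'' T'') (hK : ∀ x y, K x y = K' x y + K'' x y) {f : Lp ℝ p ρ}
    {f' : Lp ℝ p' ρ'} {f'' : Lp ℝ p'' ρ''} (h' : f =ᵐ[ν] f') (h'' : f =ᵐ[ν] f'') :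
    T f =ᵐ[ν] fun x => T' f' x + T'' f'' x := by
  filter_upwards [(hT f).2, hT' f' |>.1, (hT' f').2, (hT'' f'').1, (hT'' f'').2] with x h1 h2 h3 h4 h5
  rw [h1, h3, h5, ← integral_add h2 h4]
  refine integral_congr_ae ?_
  filter_upwards [h', h''] with y h6 h7
  rw [← h6, ← h7, hK, add_mul]

end KernelAlgebra

variable {n : ℕ} {Ω : Set (E n)} {s γ : ℝ} {L : L2 Ω →ₗ.[ℝ] L2 Ω} {G : E n → E n → ℝ}

/-- The kernel is cut at distance `ε` from the diagonal: `R` and `R'` carry the near part, `B` the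
far part. All the identities hold because each operator is determined by its kernel. -/
theorem K1.exists_green_operators (hn : 1 ≤ n) (hs : 0 < s) (hγ : γ ∈ Ioc (0 : ℝ) 1)
    (hΩo : IsOpen Ω) (hΩb : Bornology.IsBounded Ω) (hK : K1 Ω s γ L G)
    {j : L2 Ω →L[ℝ] WL1 Ω γ} (hj : ∀ g, j g =ᵐ[volume.restrict Ω] g) :
    ∃ (A : L2 Ω →L[ℝ] L2 Ω) (A' : WL1 Ω γ →L[ℝ] WL1 Ω γ),
      IsKernelOp (volume.restrict Ω) G A ∧ IsKernelOp (volume.restrict Ω) G A' ∧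
      ∀ η : ℝ, 0 < η → ∃ (R : L2 Ω →L[ℝ] L2 Ω) (R' : WL1 Ω γ →L[ℝ] WL1 Ω γ)
        (B : WL1 Ω γ →L[ℝ] L2 Ω), ‖R‖ ≤ η ∧ ‖R'‖ ≤ η ∧ A = R + B ∘L j ∧ A' = R' + j ∘L B ∧
          j ∘L R = R' ∘L j ∧ IsCompactOperator (B ∘L j) := by
  have : Nonempty (Fin n) := ⟨⟨0, hn⟩⟩
  have := isFiniteMeasure_restrict hΩb
  obtain ⟨C, r, hC, hG⟩ := hK.exists_kernelBound hγ hΩb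
  obtain ⟨A, -, hA⟩ := hG.exists_L2 hn hs hΩo hΩb hC
  obtain ⟨A', -, hA'⟩ := hG.exists_WL1 hn hs hΩo hΩb hC
  refine ⟨A, A', hA, hA', fun η hη => ?_⟩
  -- Dividing by `C + 1` rather than `C` allows `C = 0`.
  obtain ⟨ε, hε, hmass⟩ := exists_rieszMass_lt (s := s) (η := ENNReal.ofReal (η / (C + 1))) hn hs
    (ENNReal.ofReal_pos.2 (by positivity)).ne'
  have hle : (ENNReal.ofReal C * rieszMass n s ε).toReal ≤ η := by
    rw [ENNReal.toReal_mul, ENNReal.toReal_ofReal hC]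
    have h1 : (rieszMass n s ε).toReal ≤ η / (C + 1) := by
      rw [← ENNReal.toReal_ofReal (show 0 ≤ η / (C + 1) by positivity)]
      exact ENNReal.toReal_mono ENNReal.ofReal_ne_top hmass.le
    calc C * (rieszMass n s ε).toReal ≤ (C + 1) * (η / (C + 1)) :=
          mul_le_mul (by linarith) h1 ENNReal.toReal_nonneg (by linarith)
      _ = η := by field_simp
  have hN := hG.near hC ε
  obtain ⟨R, hRn, hR⟩ := hN.exists_L2 hn hs hΩo hΩb hC
  obtain ⟨R', hRn', hR'⟩ := hN.exists_WL1 hn hs hΩo hΩb hC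
  let F : E n → E n → ℝ := fun x y => G x y - if ‖x - y‖ < ε then G x y else 0
  have hFm : AEStronglyMeasurable (fun p : E n × E n => F p.1 p.2)
      ((volume.restrict Ω).prod (volume.restrict Ω)) := hG.meas.sub hN.meas
  obtain ⟨M, hM, hfar⟩ := hK.exists_far_bound hΩb hγ.1 hε
  have hF : ∀ x ∈ Ω, ∀ y ∈ Ω, |F x y| ≤ M * bdist Ω y ^ γ ∧ |F x y| ≤ M := fun x hx y hy => by
    by_cases h : ‖x - y‖ < ε
    · have := bdist_nonneg Ω y
      simp only [F, if_pos h, sub_self, abs_zero]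
      exact ⟨by positivity, hM⟩
    · simp only [F, if_neg h, sub_zero]
      exact hfar x hx y hy (not_lt.1 h)
  have hFw : ∀ᵐ x ∂(volume.restrict Ω), ∀ᵐ y ∂(volume.restrict Ω),
      ‖F x y‖ₑ ≤ ENNReal.ofReal M * wdens Ω γ y := by
    filter_upwards [ae_restrict_mem hΩo.measurableSet] with x hx
    filter_upwards [ae_restrict_mem hΩo.measurableSet] with y hy
    rw [wdens, ← ENNReal.ofReal_mul hM, Real.enorm_eq_ofReal_abs]
    exact ENNReal.ofReal_le_ofReal (hF x hx y hy).1
  have hFb : ∀ᵐ x ∂(volume.restrict Ω), ∀ᵐ y ∂(volume.restrict Ω), ‖F x y‖ ≤ M := by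
    filter_upwards [ae_restrict_mem hΩo.measurableSet] with x hx
    filter_upwards [ae_restrict_mem hΩo.measurableSet] with y hy
    exact (hF x hx y hy).2
  obtain ⟨B, -, hB⟩ := exists_isKernelOp (p := 1) (q := 2) ENNReal.ofNat_ne_top hFm
    (ac_weightedMeasure (γ := γ) hΩo hΩb) Measure.AbsolutelyContinuous.rfl
    Measure.AbsolutelyContinuous.rfl
    (ENNReal.mul_ne_top (ENNReal.rpow_ne_top_of_nonneg (by norm_num) (measure_ne_top _ _))
      ENNReal.ofReal_ne_top)
    (eLpNorm_two_lintegral_kernel_le_one (measurable_wdens Ω γ) hFw)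
  have hBj : IsKernelOp (volume.restrict Ω) F (B ∘L j) := fun f => by
    have h1 := hB (j f)
    have h2 := hj f
    constructor
    · filter_upwards [h1.1] with x hx
      refine hx.congr ?_
      filter_upwards [h2] with y hy
      rw [hy]
    · filter_upwards [h1.2] with x hx
      rw [ContinuousLinearMap.comp_apply, hx]
      refine integral_congr_ae ?_
      filter_upwards [h2] with y hy
      rw [hy]
  have hsum : ∀ x y, G x y = (if ‖x - y‖ < ε then G x y else 0) + F x y := fun x y => by
    simp [F]
  refine ⟨R, R', B, hRn.trans hle, hRn'.trans hle, ?_, ?_, ?_, hBj.isCompactOperator hFm hFb⟩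
  · ext1 f
    refine Lp.ext ?_
    filter_upwards [hA.ae_eq_add hR hBj hsum (f := f) (EventuallyEq.refl _ _)
      (EventuallyEq.refl _ _), Lp.coeFn_add (R f) ((B ∘L j) f)] with x h1 h2
    rw [h1]
    exact h2.symm
  · ext1 f
    refine Lp.ext ((weightedMeasure_ac Ω γ).ae_le ?_)
    filter_upwards [hA'.ae_eq_add hR' hB hsum (f := f) (EventuallyEq.refl _ _)
      (EventuallyEq.refl _ _), (ac_weightedMeasure hΩo hΩb).ae_le
        (Lp.coeFn_add (R' f) ((j ∘L B) f)), hj (B f)] with x h1 h2 h3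
    rw [h1, ← h3]
    exact h2.symm
  · ext1 f
    refine Lp.ext ((weightedMeasure_ac Ω γ).ae_le ?_)
    filter_upwards [hj (R f), hR'.ae_eq hR (hj f)] with x h1 h2
    rw [ContinuousLinearMap.comp_apply, ContinuousLinearMap.comp_apply, h1, h2]

theorem L2.integrable_mul_lt_top {α : Type*} [MeasurableSpace α] {ν : Measure α} {F g : α → ℝ≥0∞}
    (hF : AEMeasurable F ν) (hg : AEMeasurable g ν) (hF2 : eLpNorm F 2 ν < ⊤)
    (hg2 : eLpNorm g 2 ν < ⊤) : ∫⁻ x, F x * g x ∂ν < ⊤ := by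
  have h := ENNReal.lintegral_mul_le_Lp_mul_Lq ν Real.HolderConjugate.two_two hF hg
  rw [eLpNorm_eq_lintegral_rpow_enorm_toReal two_ne_zero ENNReal.ofNat_ne_top] at hF2 hg2
  simp only [enorm_eq_self, ENNReal.toReal_ofNat] at hF2 hg2
  exact h.trans_lt (ENNReal.mul_lt_top hF2 hg2)

/-- The transposed kernel of a symmetric Green's function defines the same operator. -/
theorem K1.ae_integral_swap [Nonempty (Fin n)] (hΩo : IsOpen Ω) (hK : K1 Ω s γ L G)
    (g : E n → ℝ) : ∀ᵐ y ∂(volume.restrict Ω), ∫ x in Ω, G x y * g x = greenOp Ω G g y := by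
  filter_upwards [ae_restrict_mem hΩo.measurableSet] with y hy
  refine integral_congr_ae ?_
  filter_upwards [ae_ne_mem hΩo y] with x hx
  rw [hK.symm x hx.1 y hy hx.2]

/-- The `L²` Schur bound for `|G|` justifies Fubini; the diagonal, where symmetry is not assumed,
meets each slice in a null set. -/
theorem K1.isSymmetric (hn : 1 ≤ n) (hs : 0 < s) (hγ : γ ∈ Ioc (0 : ℝ) 1) (hΩo : IsOpen Ω)
    (hΩb : Bornology.IsBounded Ω) (hK : K1 Ω s γ L G) {A : L2 Ω →L[ℝ] L2 Ω}
    (hA : IsKernelOp (volume.restrict Ω) G A) : (A : L2 Ω →ₗ[ℝ] L2 Ω).IsSymmetric := by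
  have : Nonempty (Fin n) := ⟨⟨0, hn⟩⟩
  have := isFiniteMeasure_restrict hΩb
  obtain ⟨C, r, hC, hG⟩ := hK.exists_kernelBound hγ hΩb
  intro f g
  have hb := hG.eLpNorm_two_le hn hΩo hΩb hC f (Lp.aestronglyMeasurable f)
  have hm := (aestronglyMeasurable_kernel_mul hG.meas (Lp.aestronglyMeasurable f)).enorm
  simp only [enorm_mul] at hm
  have hfin : ∫⁻ x in Ω, (∫⁻ y in Ω, ‖G x y‖ₑ * ‖f y‖ₑ) * ‖g x‖ₑ < ⊤ := by
    refine L2.integrable_mul_lt_top hm.lintegral_prod_right' (Lp.aestronglyMeasurable g).enorm ?_ ?_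
    · exact hb.trans_lt (ENNReal.mul_lt_top (ENNReal.mul_ne_top ENNReal.ofReal_ne_top
        (rieszMass_ne_top hn hs r)).lt_top (Lp.eLpNorm_lt_top f))
    · have := Lp.eLpNorm_lt_top g
      rwa [← eLpNorm_enorm] at this
  obtain ⟨-, -, h⟩ := integral_kernel_mul hG.meas (Lp.aestronglyMeasurable f)
    (Lp.aestronglyMeasurable g) hfin
  change inner ℝ (A f) g = inner ℝ f (A g)
  rw [L2.inner_def, L2.inner_def]
  refine (integral_congr_ae ?_).trans (h.trans (integral_congr_ae ?_))
  · filter_upwards [(hA f).2] with x hx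
    simp [hx, mul_comm]
  · filter_upwards [(hA g).2, hK.ae_integral_swap hΩo g] with x h1 h2
    rw [h2]
    simp only [RCLike.inner_apply, conj_trivial, h1]
    rw [mul_comm]
    rfl

end GreenNotions

/-! ### The eigenbasis and the resolvent on `L²` -/

namespace GreenNotions

variable {n : ℕ} {Ω : Set (E n)} {s γ : ℝ} {L : L2 Ω →ₗ.[ℝ] L2 Ω} {G : E n → E n → ℝ}

/-- `Ω` contains infinitely many disjoint nonempty open sets, whose indicators are orthogonal and
nonzero. -/
theorem not_finiteDimensional_L2 [Nonempty (Fin n)] (hΩo : IsOpen Ω)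
    (hΩb : Bornology.IsBounded Ω) (hΩn : Ω.Nonempty) : ¬ FiniteDimensional ℝ (L2 Ω) := by
  intro hfd
  have := isFiniteMeasure_restrict hΩb
  have hinf : Infinite Ω := by
    rw [Set.infinite_coe_iff]
    obtain ⟨x, hx⟩ := hΩn
    exact infinite_of_mem_nhds x (hΩo.mem_nhds hx)
  obtain ⟨U, hUi, hUo, hd⟩ := exists_seq_infinite_isOpen_pairwise_disjoint Ω
  let V : ℕ → Set (E n) := fun k => Subtype.val '' U k
  have hVo : ∀ k, IsOpen (V k) := fun k => hΩo.isOpenMap_subtype_val _ (hUo k)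
  have hVΩ : ∀ k, V k ⊆ Ω := fun k => by
    rintro _ ⟨x, -, rfl⟩
    exact x.2
  have hVpos : ∀ k, (volume.restrict Ω) (V k) ≠ 0 := fun k => by
    rw [Measure.restrict_apply (hVo k).measurableSet, inter_eq_left.2 (hVΩ k)]
    exact ((hVo k).measure_pos volume ((hUi k).nonempty.image _)).ne'
  let v : ℕ → L2 Ω := fun k => indicatorConstLp 2 (hVo k).measurableSet
    (measure_ne_top (volume.restrict Ω) _) (1 : ℝ)
  have hreal : ∀ k, (volume.restrict Ω).real (V k) ≠ 0 := fun k =>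
    (ENNReal.toReal_pos (hVpos k) (measure_ne_top _ _)).ne'
  have hli : LinearIndependent ℝ v := by
    refine linearIndependent_of_ne_zero_of_inner_eq_zero (𝕜 := ℝ) (fun k h0 => ?_)
      (fun i k hik => ?_)
    · have h1 : inner ℝ (v k) (v k) = 0 := by rw [h0, inner_zero_left]
      rw [L2.inner_indicatorConstLp_indicatorConstLp, inter_self] at h1
      simp [hreal k] at h1
    · have h2 : V i ∩ V k = ∅ := by
        rw [← disjoint_iff_inter_eq_empty]
        exact (disjoint_image_iff Subtype.val_injective).2 (hd hik)
      simp only [v]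
      rw [L2.inner_indicatorConstLp_indicatorConstLp, h2]
      simp
  exact not_finite_iff_infinite.2 inferInstance hli.finite

theorem IsGreenFunction.exists_domain (hG : IsGreenFunction Ω L G) {A : L2 Ω →L[ℝ] L2 Ω}
    (hA : IsKernelOp (volume.restrict Ω) G A) (f : L2 Ω) :
    ∃ u : L.domain, (u : L2 Ω) = A f ∧ L u = f := by
  obtain ⟨u, hu, hLu⟩ := hG.right_inv f
  refine ⟨u, Lp.ext ?_, hLu⟩
  filter_upwards [hu, (hA f).2] with x h1 h2
  rw [h1, h2, greenOp]

theorem IsGreenFunction.apply_apply (hG : IsGreenFunction Ω L G) {A : L2 Ω →L[ℝ] L2 Ω}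
    (hA : IsKernelOp (volume.restrict Ω) G A) (u : L.domain) : A (L u) = u := by
  refine Lp.ext ?_
  filter_upwards [hG.left_inv u, (hA (L u)).2] with x h1 h2
  rw [h1, h2, greenOp]

theorem IsEigenbasis.green_apply {lam : ℕ → ℝ} {φ : HilbertBasis ℕ ℝ (L2 Ω)}
    (hφ : IsEigenbasis L lam φ) (hG : IsGreenFunction Ω L G) {A : L2 Ω →L[ℝ] L2 Ω}
    (hA : IsKernelOp (volume.restrict Ω) G A) (k : ℕ) : A (φ k) = (lam k)⁻¹ • φ k := by
  obtain ⟨h, hk⟩ := hφ.eigen k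
  have h1 := hG.apply_apply hA ⟨φ k, h⟩
  rw [hk, map_smul] at h1
  rw [eq_inv_smul_iff₀ (hφ.pos k).ne']
  exact h1

/-- The spectral theorem is applied to `A`: it is injective because `L` undoes it, and positive
because `⟨v, A v⟩ = ⟨L u, u⟩` for `u = A v`. -/
theorem K1.exists_isEigenbasis [Nonempty (Fin n)] (hΩo : IsOpen Ω)
    (hΩb : Bornology.IsBounded Ω) (hΩn : Ω.Nonempty) (hK : K1 Ω s γ L G) {A : L2 Ω →L[ℝ] L2 Ω}
    (hA : IsKernelOp (volume.restrict Ω) G A) (hcomp : IsCompactOperator A)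
    (hsymm : (A : L2 Ω →ₗ[ℝ] L2 Ω).IsSymmetric) :
    ∃ (lam : ℕ → ℝ) (φ : HilbertBasis ℕ ℝ (L2 Ω)), IsEigenbasis L lam φ := by
  obtain ⟨lam, φ, hpos, hmono, htend, hφ⟩ := exists_hilbertBasis_eigenvectors
    (not_finiteDimensional_L2 hΩo hΩb hΩn) hcomp hsymm (fun v hv => by
      obtain ⟨u, hu, hLu⟩ := hK.green.exists_domain hA v
      rw [hv] at hu
      have : u = 0 := Subtype.ext hu
      rw [← hLu, this, L.map_zero]) (fun v => by
      obtain ⟨u, hu, hLu⟩ := hK.green.exists_domain hA v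
      have := hK.nonneg u
      rwa [hu, hLu] at this)
  refine ⟨lam, φ, hpos, hmono, htend, fun k => ?_⟩
  obtain ⟨u, hu, hLu⟩ := hK.green.exists_domain hA (φ k)
  -- An eigenvector of `A` is a multiple of its image under `A`, hence lies in the domain of `L`.
  have h1 : φ k = ((lam k • u : L.domain) : L2 Ω) := by
    rw [Submodule.coe_smul, hu, hφ, smul_inv_smul₀ (hpos k).ne']
  have h2 : φ k ∈ L.domain := by
    rw [h1]
    exact (lam k • u).2
  refine ⟨h2, ?_⟩
  have h3 : (⟨φ k, h2⟩ : L.domain) = lam k • u := Subtype.ext h1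
  rw [h3, L.map_smul, hLu]

section Resolvent

variable {lam : ℕ → ℝ} {φ : HilbertBasis ℕ ℝ (L2 Ω)} {μ : ℝ}

theorem IsEigenbasis.exists_resolvent (hφ : IsEigenbasis L lam φ) (hμ : μ ∉ range lam) :
    ∃ Γ : L2 Ω →L[ℝ] L2 Ω, ∀ g, HasSum (resolventTerm lam φ μ g) (Γ g) := by
  obtain ⟨d, hd, hle⟩ := exists_pos_le_abs_sub hφ.tendsto hμ
  obtain ⟨Γ, hΓ⟩ := exists_diagonal_clm φ (fun k => (lam k - μ)⁻¹) d⁻¹ fun k => by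
    rw [abs_inv]
    exact inv_anti₀ hd (hle k)
  refine ⟨Γ, fun g => (hΓ g).congr_fun fun k => ?_⟩
  rw [resolventTerm, div_eq_inv_mul]

variable {Γ : L2 Ω →L[ℝ] L2 Ω}

theorem inner_resolvent (hΓ : ∀ g, HasSum (resolventTerm lam φ μ g) (Γ g)) (g : L2 Ω) (k : ℕ) :
    inner ℝ (Γ g) (φ k) = inner ℝ g (φ k) / (lam k - μ) := by
  have h := (hΓ g).mapL (innerSL ℝ (φ k))
  rw [real_inner_comm]
  refine h.unique ((hasSum_ite_eq k (inner ℝ g (φ k) / (lam k - μ))).congr_fun fun i => ?_)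
  simp only [resolventTerm, innerSL_apply_apply, inner_smul_right,
    orthonormal_iff_ite.1 φ.orthonormal]
  by_cases h : k = i
  · simp [h]
  · simp [h, Ne.symm h]

theorem resolvent_apply_basis (hΓ : ∀ g, HasSum (resolventTerm lam φ μ g) (Γ g)) (k : ℕ) :
    Γ (φ k) = (lam k - μ)⁻¹ • φ k := by
  refine (hΓ (φ k)).unique ((hasSum_ite_eq k ((lam k - μ)⁻¹ • φ k)).congr_fun fun i => ?_)
  simp only [resolventTerm, orthonormal_iff_ite.1 φ.orthonormal]
  by_cases h : k = i
  · simp [h]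
  · simp [h, Ne.symm h]

theorem inner_resolvent_comm (hΓ : ∀ g, HasSum (resolventTerm lam φ μ g) (Γ g)) (f g : L2 Ω) :
    inner ℝ (Γ f) g = inner ℝ f (Γ g) := by
  refine (φ.hasSum_inner_mul_inner (Γ f) g).unique
    ((φ.hasSum_inner_mul_inner f (Γ g)).congr_fun fun k => ?_)
  rw [inner_resolvent hΓ, real_inner_comm (Γ g), inner_resolvent hΓ, real_inner_comm g]
  ring

/-- On each eigenvector this is `1/(λ-μ) - μ/(λ(λ-μ)) = 1/λ`. -/
theorem resolvent_identity (hlam : ∀ k, 0 < lam k) (hμ : μ ∉ range lam)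
    (hΓ : ∀ g, HasSum (resolventTerm lam φ μ g) (Γ g)) {A : L2 Ω →L[ℝ] L2 Ω}
    (hA : ∀ k, A (φ k) = (lam k)⁻¹ • φ k) :
    Γ - μ • (Γ ∘L A) = A ∧ Γ - μ • (A ∘L Γ) = A := by
  have key : ∀ k, (lam k - μ)⁻¹ - μ * ((lam k)⁻¹ * (lam k - μ)⁻¹) = (lam k)⁻¹ := fun k => by
    have h1 := (hlam k).ne'
    have h2 : lam k - μ ≠ 0 := sub_ne_zero.2 fun h => hμ ⟨k, h⟩
    field_simp
  constructor <;> refine clm_ext_hilbertBasis φ fun k => ?_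
  · change Γ (φ k) - μ • Γ (A (φ k)) = A (φ k)
    rw [hA, map_smul, resolvent_apply_basis hΓ, smul_smul, smul_smul, ← sub_smul, mul_assoc, key]
  · change Γ (φ k) - μ • A (Γ (φ k)) = A (φ k)
    rw [resolvent_apply_basis hΓ, map_smul, hA, smul_smul, smul_smul, ← sub_smul, mul_assoc,
      mul_comm (lam k - μ)⁻¹ (lam k)⁻¹, key]

theorem resolventL2_eq (hΓ : ∀ g, HasSum (resolventTerm lam φ μ g) (Γ g)) (g : L2 Ω) :
    resolventL2 lam φ μ g = Γ g := (hΓ g).tsum_eq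

/-- In this form, uniqueness is immediate from density of the range of `j`. -/
theorem isResolventExtension_iff
    (hΓ : ∀ g, HasSum (resolventTerm lam φ μ g) (Γ g))
    {j : L2 Ω →L[ℝ] WL1 Ω γ} (hj : ∀ g, j g =ᵐ[volume.restrict Ω] g)
    (T : WL1 Ω γ →L[ℝ] WL1 Ω γ) : IsResolventExtension lam φ μ T ↔ T ∘L j = j ∘L Γ := by
  constructor
  · intro h
    ext1 g
    refine Lp.ext ((weightedMeasure_ac Ω γ).ae_le ?_)
    have h1 := h g (j g) (hj g)
    rw [resolventL2_eq hΓ] at h1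
    exact h1.trans (hj (Γ g)).symm
  · intro h g g' hg
    have h1 : g' = j g := Lp.ext ((weightedMeasure_ac Ω γ).ae_le (hg.trans (hj g).symm))
    rw [resolventL2_eq hΓ, h1]
    have h2 : T (j g) = j (Γ g) := DFunLike.congr_fun h g
    rw [h2]
    exact hj (Γ g)

end Resolvent

end GreenNotions

/-! ### Duality between `L¹(Ω; δ^γ)` and `δ^γ L^∞(Ω)` -/

namespace GreenNotions

variable {n : ℕ} {Ω : Set (E n)} {s γ : ℝ} {L : L2 Ω →ₗ.[ℝ] L2 Ω} {G : E n → E n → ℝ}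

/-- The value at `0` is `1`, so that `|σ| = 1` everywhere. -/
theorem exists_measurable_sign :
    ∃ σ : ℝ → ℝ, Measurable σ ∧ ∀ x, |σ x| = 1 ∧ x * σ x = |x| := by
  refine ⟨fun x => if 0 ≤ x then 1 else -1,
    Measurable.ite measurableSet_Ici measurable_const measurable_const, fun x => ?_⟩
  by_cases h : 0 ≤ x
  · simp [h, abs_of_nonneg h]
  · simp [h, abs_of_neg (not_le.1 h)]

theorem WL1.integrable_mul_bdist (f : WL1 Ω γ) :
    Integrable (fun x => |f x| * bdist Ω x ^ γ) (volume.restrict Ω) := by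
  have h : Integrable (fun x => ‖f x‖) ((volume.restrict Ω).withDensity (wdens Ω γ)) :=
    (L1.integrable_coeFn f).norm
  rw [integrable_withDensity_iff_integrable_smul₀'
    (measurable_wdens Ω γ).aemeasurable (Eventually.of_forall fun x => ENNReal.ofReal_lt_top)] at h
  refine h.congr (Eventually.of_forall fun x => ?_)
  simp only [wdens, smul_eq_mul, Real.norm_eq_abs]
  rw [ENNReal.toReal_ofReal (Real.rpow_nonneg (bdist_nonneg Ω x) γ), mul_comm]

theorem WL1.norm_eq (f : WL1 Ω γ) : ‖f‖ = ∫ x in Ω, |f x| * bdist Ω x ^ γ := by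
  rw [L1.norm_eq_integral_norm]
  change ∫ x, ‖f x‖ ∂((volume.restrict Ω).withDensity (wdens Ω γ)) = _
  rw [integral_withDensity_eq_integral_toReal_smul₀ (measurable_wdens Ω γ).aemeasurable
    (Eventually.of_forall fun x => ENNReal.ofReal_lt_top)]
  refine integral_congr_ae (Eventually.of_forall fun x => ?_)
  simp only [wdens, smul_eq_mul, Real.norm_eq_abs]
  rw [ENNReal.toReal_ofReal (Real.rpow_nonneg (bdist_nonneg Ω x) γ), mul_comm]

/-- `ψ` is a measurable function on `Ω` with `|ψ| ≤ C δ^γ` almost everywhere. -/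
def BoundedByWeight (Ω : Set (E n)) (γ C : ℝ) (ψ : E n → ℝ) : Prop :=
  AEStronglyMeasurable ψ (volume.restrict Ω) ∧ ∀ᵐ x ∂(volume.restrict Ω), |ψ x| ≤ C * bdist Ω x ^ γ

section Pairing

variable {C : ℝ} {ψ : E n → ℝ}

theorem WL1.aestronglyMeasurable [Nonempty (Fin n)] (hΩo : IsOpen Ω)
    (hΩb : Bornology.IsBounded Ω) (f : WL1 Ω γ) : AEStronglyMeasurable f (volume.restrict Ω) :=
  (Lp.aestronglyMeasurable f).mono_ac (ac_weightedMeasure hΩo hΩb)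

theorem BoundedByWeight.integrable_mul [Nonempty (Fin n)] (hΩo : IsOpen Ω)
    (hΩb : Bornology.IsBounded Ω) (hψ : BoundedByWeight Ω γ C ψ) (f : WL1 Ω γ) :
    Integrable (fun x => f x * ψ x) (volume.restrict Ω) := by
  refine ((WL1.integrable_mul_bdist f).const_mul C).mono'
    ((WL1.aestronglyMeasurable hΩo hΩb f).mul hψ.1) ?_
  filter_upwards [hψ.2] with x hx
  rw [norm_mul, Real.norm_eq_abs, Real.norm_eq_abs]
  calc |f x| * |ψ x| ≤ |f x| * (C * bdist Ω x ^ γ) := by gcongr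
    _ = _ := by ring

theorem BoundedByWeight.exists_functional [Nonempty (Fin n)] (hΩo : IsOpen Ω)
    (hΩb : Bornology.IsBounded Ω) (hψ : BoundedByWeight Ω γ C ψ) :
    ∃ Λ : WL1 Ω γ →L[ℝ] ℝ, ∀ f, Λ f = ∫ x in Ω, f x * ψ x := by
  let Λ : WL1 Ω γ →ₗ[ℝ] ℝ :=
    { toFun := fun f => ∫ x in Ω, f x * ψ x
      map_add' := fun f g => by
        rw [← integral_add (hψ.integrable_mul hΩo hΩb f) (hψ.integrable_mul hΩo hΩb g)]
        refine integral_congr_ae ?_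
        filter_upwards [(ac_weightedMeasure hΩo hΩb).ae_le (Lp.coeFn_add f g)] with x hx
        rw [hx, Pi.add_apply, add_mul]
      map_smul' := fun c f => by
        rw [RingHom.id_apply, smul_eq_mul, ← integral_const_mul]
        refine integral_congr_ae ?_
        filter_upwards [(ac_weightedMeasure hΩo hΩb).ae_le (Lp.coeFn_smul c f)] with x hx
        rw [hx, Pi.smul_apply, smul_eq_mul, mul_assoc] }
  refine ⟨Λ.mkContinuous C fun f => ?_, fun f => rfl⟩
  change ‖∫ x in Ω, f x * ψ x‖ ≤ _
  rw [WL1.norm_eq, ← integral_const_mul]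
  refine norm_integral_le_of_norm_le ((WL1.integrable_mul_bdist f).const_mul C) ?_
  filter_upwards [hψ.2] with x hx
  rw [norm_mul, Real.norm_eq_abs, Real.norm_eq_abs]
  calc |f x| * |ψ x| ≤ |f x| * (C * bdist Ω x ^ γ) := by gcongr
    _ = _ := by ring

theorem memLp_two_of_bound (hΩb : Bornology.IsBounded Ω) (hψm : AEStronglyMeasurable ψ
    (volume.restrict Ω)) (hψ : ∀ᵐ x ∂(volume.restrict Ω), |ψ x| ≤ C) :
    MemLp ψ 2 (volume.restrict Ω) := by
  have := isFiniteMeasure_restrict hΩb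
  exact MemLp.of_bound hψm C hψ

/-- Testing with `sign(f) δ^γ` recovers the norm of `f`. -/
theorem WL1.eq_zero_of_integral_mul_eq_zero [Nonempty (Fin n)] (f : WL1 Ω γ)
    (h : ∀ (ψ : E n → ℝ) (C : ℝ), BoundedByWeight Ω γ C ψ → ∫ x in Ω, f x * ψ x = 0) : f = 0 := by
  obtain ⟨σ, hσ, hσ'⟩ := exists_measurable_sign
  have hm : Measurable fun x => σ (f x) * bdist Ω x ^ γ :=
    (hσ.comp (Lp.stronglyMeasurable f).measurable).mul ((measurable_bdist Ω).pow_const γ)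
  have h1 := h (fun x => σ (f x) * bdist Ω x ^ γ) 1 ⟨hm.aestronglyMeasurable,
    Eventually.of_forall fun x => by
      rw [abs_mul, (hσ' _).1, abs_of_nonneg (Real.rpow_nonneg (bdist_nonneg Ω x) γ)]⟩
  rw [← norm_eq_zero, WL1.norm_eq, ← h1]
  refine integral_congr_ae (Eventually.of_forall fun x => ?_)
  simp only [← mul_assoc, (hσ' _).2]

/-- Testing with the sign of `g` on `S = {|g| > C δ^γ}` gives `∫_S (|g| - C δ^γ) ≤ 0`. The integrand
is positive on `S`, so `S` is null. -/
theorem boundedByWeight_of_dual_bound (hΩb : Bornology.IsBounded Ω)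
    {j : L2 Ω →L[ℝ] WL1 Ω γ} (hj : ∀ g, j g =ᵐ[volume.restrict Ω] g) (g : L2 Ω)
    (hg : ∀ f : L2 Ω, |inner ℝ g f| ≤ C * ‖j f‖) : BoundedByWeight Ω γ C g := by
  refine ⟨Lp.aestronglyMeasurable g, ?_⟩
  obtain ⟨σ, hσ, hσ'⟩ := exists_measurable_sign
  have hgm : Measurable g := (Lp.stronglyMeasurable g).measurable
  let S : Set (E n) := {x | C * bdist Ω x ^ γ < |g x|}
  have hS : MeasurableSet S := measurableSet_lt
    (((measurable_bdist Ω).pow_const γ).const_mul C) (measurable_norm.comp hgm)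
  have hfm : Measurable (S.indicator fun x => σ (g x)) := (hσ.comp hgm).indicator hS
  have hf1 : ∀ x, |S.indicator (fun x => σ (g x)) x| = S.indicator (fun _ => (1 : ℝ)) x :=
    fun x => by
    by_cases h : x ∈ S
    · simp [h, (hσ' _).1]
    · simp [h]
  have hmem : MemLp (S.indicator fun x => σ (g x)) 2 (volume.restrict Ω) :=
    memLp_two_of_bound hΩb hfm.aestronglyMeasurable (C := 1) (Eventually.of_forall fun x => by
      rw [hf1]
      exact indicator_le_self' (fun _ _ => zero_le_one) x)
  let f : L2 Ω := hmem.toLp _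
  have hf : f =ᵐ[volume.restrict Ω] S.indicator fun x => σ (g x) := hmem.coeFn_toLp
  have h1 : inner ℝ g f = ∫ x in Ω, S.indicator (fun x => |g x|) x := by
    rw [L2.inner_def]
    refine integral_congr_ae ?_
    filter_upwards [hf] with x hx
    rw [hx]
    by_cases h : x ∈ S
    · simp only [h, indicator_of_mem, RCLike.inner_apply, conj_trivial]
      rw [mul_comm, (hσ' _).2]
    · simp [h]
  have h2 : (fun x => |j f x| * bdist Ω x ^ γ) =ᵐ[volume.restrict Ω]
      S.indicator fun x => bdist Ω x ^ γ := by
    filter_upwards [hf, hj f] with x hx hx'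
    rw [hx', hx, hf1]
    by_cases h : x ∈ S <;> simp [h]
  have h3 := hg f
  rw [WL1.norm_eq, integral_congr_ae h2, h1, ← integral_const_mul] at h3
  have hi1 : Integrable (fun x => S.indicator (fun x => |g x|) x) (volume.restrict Ω) := by
    have := isFiniteMeasure_restrict hΩb
    exact (((Lp.memLp g).integrable one_le_two).abs).indicator hS
  have hi2 : Integrable (fun x => C * S.indicator (fun x => bdist Ω x ^ γ) x)
      (volume.restrict Ω) :=
    (((WL1.integrable_mul_bdist (j f)).congr h2)).const_mul C
  have h4 : ∫ x in Ω, (S.indicator (fun x => |g x|) x -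
      C * S.indicator (fun x => bdist Ω x ^ γ) x) ≤ 0 := by
    rw [integral_sub hi1 hi2, sub_nonpos]
    exact (le_abs_self _).trans h3
  have h5 : ∀ x, 0 ≤ S.indicator (fun x => |g x|) x -
      C * S.indicator (fun x => bdist Ω x ^ γ) x := fun x => by
    by_cases h : x ∈ S
    · simp only [h, indicator_of_mem, sub_nonneg]
      exact le_of_lt h
    · simp [h]
  have h6 := (integral_eq_zero_iff_of_nonneg h5 (hi1.sub hi2)).1
    (le_antisymm h4 (integral_nonneg h5))
  filter_upwards [h6] with x hx
  by_contra hlt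
  have hxS : x ∈ S := not_le.1 hlt
  simp only [hxS, indicator_of_mem, Pi.zero_apply, sub_eq_zero] at hx
  exact hlt hx.le

theorem exists_bdist_rpow_lower_bound [Nonempty (Fin n)] (hΩo : IsOpen Ω)
    (hΩb : Bornology.IsBounded Ω) (γ : ℝ) {K : Set (E n)} (hK : IsCompact K) (hKΩ : K ⊆ Ω) :
    ∃ c > 0, ∀ x ∈ K, c ≤ bdist Ω x ^ γ := by
  rcases K.eq_empty_or_nonempty with rfl | hne
  · exact ⟨1, one_pos, by simp⟩
  · have hc : ContinuousOn (fun x => bdist Ω x ^ γ) K := fun x hx =>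
      ((Metric.continuous_infDist_pt _).continuousAt.rpow_const
        (Or.inl (bdist_pos hΩo hΩb (hKΩ hx)).ne')).continuousWithinAt
    obtain ⟨z, hz, hmin⟩ := hK.exists_isMinOn hne hc
    exact ⟨_, Real.rpow_pos_of_pos (bdist_pos hΩo hΩb (hKΩ hz)) γ, fun x hx => hmin hx⟩

/-- `δ^γ` is bounded below on compact subsets of `Ω`; thus the compactly supported test classes fall
under the same pairing. -/
theorem MemLinftyC.exists_boundedByWeight [Nonempty (Fin n)] (hΩo : IsOpen Ω)
    (hΩb : Bornology.IsBounded Ω) (hψ : MemLinftyC Ω ψ) : ∃ C, BoundedByWeight Ω γ C ψ := by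
  obtain ⟨M, hM⟩ := hψ.bounded
  obtain ⟨K, hK, hKΩ, hKψ⟩ := hψ.support
  obtain ⟨c, hc, hcK⟩ := exists_bdist_rpow_lower_bound hΩo hΩb γ hK hKΩ
  refine ⟨|M| / c, hψ.meas, ?_⟩
  filter_upwards [hM, hKψ] with x h1 h2
  have hd := Real.rpow_nonneg (bdist_nonneg Ω x) γ
  by_cases hx : x ∈ K
  · calc |ψ x| ≤ |M| / c * c := by
          rw [div_mul_cancel₀ _ hc.ne']
          exact h1.trans (le_abs_self M)
      _ ≤ _ := by
          gcongr
          exact hcK x hx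
  · rw [h2 hx, abs_zero]
    positivity

theorem MemSmoothC.memLinftyC (hψ : MemSmoothC Ω ψ) : MemLinftyC Ω ψ where
  meas := hψ.smooth.continuous.aestronglyMeasurable
  bounded := by
    obtain ⟨C, hC⟩ := hψ.compact.exists_bound_of_continuous hψ.smooth.continuous
    exact ⟨C, Eventually.of_forall hC⟩
  support := ⟨tsupport ψ, hψ.compact, hψ.support, Eventually.of_forall fun x hx =>
    image_eq_zero_of_notMem_tsupport hx⟩

/-- The fundamental lemma of the calculus of variations. Local integrability follows by pairing `f`
with indicators of compact sets. -/
theorem WL1.eq_zero_of_integral_smooth_eq_zero [Nonempty (Fin n)] (hΩo : IsOpen Ω)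
    (hΩb : Bornology.IsBounded Ω) (f : WL1 Ω γ)
    (h : ∀ ψ : E n → ℝ, MemSmoothC Ω ψ → ∫ x in Ω, f x * ψ x = 0) : f = 0 := by
  have hloc : LocallyIntegrableOn f Ω volume := by
    rw [locallyIntegrableOn_iff hΩo.isLocallyClosed]
    intro K hKΩ hK
    have hψ : MemLinftyC Ω (K.indicator fun _ => (1 : ℝ)) :=
      { meas := (measurable_const.indicator hK.measurableSet).aestronglyMeasurable
        bounded := ⟨1, Eventually.of_forall fun x => by
          by_cases hx : x ∈ K <;> simp [hx]⟩
        support := ⟨K, hK, hKΩ, Eventually.of_forall fun x hx => by simp [hx]⟩ }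
    obtain ⟨C, hC⟩ := hψ.exists_boundedByWeight (γ := γ) hΩo hΩb
    have h1 := hC.integrable_mul hΩo hΩb f
    have h2 : (fun x => f x * K.indicator (fun _ => (1 : ℝ)) x) = K.indicator f := by
      ext x
      by_cases hx : x ∈ K <;> simp [hx]
    rw [h2, integrable_indicator_iff hK.measurableSet, IntegrableOn,
      Measure.restrict_restrict hK.measurableSet, inter_eq_left.2 hKΩ] at h1
    exact h1
  have h1 := hΩo.ae_eq_zero_of_integral_contDiff_smul_eq_zero hloc fun g hg hgc hgΩ => by
    have h2 := h g ⟨hg, hgc, hgΩ⟩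
    rw [setIntegral_eq_integral_of_forall_compl_eq_zero] at h2
    · rw [← h2]
      refine integral_congr_ae (Eventually.of_forall fun x => ?_)
      simp [mul_comm]
    · intro x hx
      rw [image_eq_zero_of_notMem_tsupport fun hx' => hx (hgΩ hx'), mul_zero]
  refine Lp.ext ((weightedMeasure_ac Ω γ).ae_le ?_)
  have h3 := (ac_weightedMeasure (γ := γ) hΩo hΩb).ae_le (Lp.coeFn_zero ℝ 1 (weightedMeasure Ω γ))
  filter_upwards [(ae_restrict_iff' hΩo.measurableSet).2 h1, h3] with x h4 h5
  rw [h4, h5, Pi.zero_apply]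

/-- Since `|ψ| ≤ |C| δ^γ`, the weighted `L¹` Schur bound makes the double integral absolutely
convergent; then Fubini and symmetry apply. -/
theorem K1.integral_green_mul (hn : 1 ≤ n) (hs : 0 < s) (hγ : γ ∈ Ioc (0 : ℝ) 1) (hΩo : IsOpen Ω)
    (hΩb : Bornology.IsBounded Ω) (hK : K1 Ω s γ L G) {A' : WL1 Ω γ →L[ℝ] WL1 Ω γ}
    (hA' : IsKernelOp (volume.restrict Ω) G A') (hψ : BoundedByWeight Ω γ C ψ) (f : WL1 Ω γ) :
    Integrable (fun x => f x * greenOp Ω G ψ x) (volume.restrict Ω) ∧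
      ∫ x in Ω, A' f x * ψ x = ∫ x in Ω, f x * greenOp Ω G ψ x := by
  have : Nonempty (Fin n) := ⟨⟨0, hn⟩⟩
  have := isFiniteMeasure_restrict hΩb
  obtain ⟨c, r, hc, hG⟩ := hK.exists_kernelBound hγ hΩb
  have hfm := WL1.aestronglyMeasurable hΩo hΩb f
  have hm := (aestronglyMeasurable_kernel_mul hG.meas hfm).enorm
  simp only [enorm_mul] at hm
  have hb := eLpNorm_one_lintegral_kernel_le hG.meas (measurable_wdens Ω γ)
      (hG.ae_lintegral_wdens_le hn hΩo hc) f hfm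
  rw [eLpNorm_one_eq_lintegral_enorm, lintegral_withDensity_eq_lintegral_mul₀
    (measurable_wdens Ω γ).aemeasurable hm.lintegral_prod_right'.enorm] at hb
  simp only [enorm_eq_self] at hb
  have hfin : ∫⁻ x in Ω, (∫⁻ y in Ω, ‖G x y‖ₑ * ‖f y‖ₑ) * ‖ψ x‖ₑ < ⊤ := by
    calc ∫⁻ x in Ω, (∫⁻ y in Ω, ‖G x y‖ₑ * ‖f y‖ₑ) * ‖ψ x‖ₑ
        ≤ ∫⁻ x in Ω, ENNReal.ofReal |C| *
            (wdens Ω γ x * ∫⁻ y in Ω, ‖G x y‖ₑ * ‖f y‖ₑ) := by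
          refine lintegral_mono_ae ?_
          filter_upwards [hψ.2] with x hx
          have h1 : ‖ψ x‖ₑ ≤ ENNReal.ofReal |C| * wdens Ω γ x := by
            rw [wdens, ← ENNReal.ofReal_mul (abs_nonneg C), Real.enorm_eq_ofReal_abs]
            exact ENNReal.ofReal_le_ofReal (hx.trans (mul_le_mul_of_nonneg_right (le_abs_self C)
              (Real.rpow_nonneg (bdist_nonneg Ω x) γ)))
          calc _ ≤ (∫⁻ y in Ω, ‖G x y‖ₑ * ‖f y‖ₑ) * (ENNReal.ofReal |C| * wdens Ω γ x) :=
                mul_le_mul_right h1 _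
            _ = _ := by ring
      _ = ENNReal.ofReal |C| * ∫⁻ x in Ω, (wdens Ω γ x * ∫⁻ y in Ω, ‖G x y‖ₑ * ‖f y‖ₑ) :=
          lintegral_const_mul' _ _ ENNReal.ofReal_ne_top
      _ < ⊤ := by
          refine ENNReal.mul_lt_top ENNReal.ofReal_lt_top (hb.trans_lt ?_)
          exact ENNReal.mul_lt_top (ENNReal.mul_ne_top ENNReal.ofReal_ne_top
            (rieszMass_ne_top hn hs r)).lt_top (Lp.eLpNorm_lt_top f)
  obtain ⟨-, h2, h3⟩ := integral_kernel_mul hG.meas hfm hψ.1 hfin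
  have hsw := hK.ae_integral_swap hΩo ψ
  constructor
  · refine h2.congr ?_
    filter_upwards [hsw] with x hx
    rw [hx]
  · refine (integral_congr_ae ?_).trans (h3.trans (integral_congr_ae ?_))
    · filter_upwards [(hA' f).2] with x hx
      rw [hx]
    · filter_upwards [hsw] with x hx
      rw [hx]

end Pairing

end GreenNotions

/-! ### Each notion of solution as an equation in `L¹(Ω; δ^γ)` -/

namespace GreenNotions

variable {n : ℕ} {Ω : Set (E n)} {s γ : ℝ} {L : L2 Ω →ₗ.[ℝ] L2 Ω} {G : E n → E n → ℝ}
  {lam : ℕ → ℝ} {φ : HilbertBasis ℕ ℝ (L2 Ω)} {μ : ℝ} {Γ : L2 Ω →L[ℝ] L2 Ω}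
  {A : L2 Ω →L[ℝ] L2 Ω} {A' T : WL1 Ω γ →L[ℝ] WL1 Ω γ} {j : L2 Ω →L[ℝ] WL1 Ω γ}

theorem WL1.ext_iff_ae
    {f g : WL1 Ω γ} : f = g ↔ f =ᵐ[volume.restrict Ω] g :=
  ⟨fun h => h ▸ EventuallyEq.refl _ _, fun h => Lp.ext ((weightedMeasure_ac Ω γ).ae_le h)⟩

/-- Both sides are continuous and agree on the dense range of `j`. -/
theorem extension_identity (hj : DenseRange j) (hT : T ∘L j = j ∘L Γ) (hA : A' ∘L j = j ∘L A)
    (hΓ : Γ - μ • (Γ ∘L A) = A ∧ Γ - μ • (A ∘L Γ) = A) (f : WL1 Ω γ) :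
    T f - μ • T (A' f) = A' f ∧ T f - μ • A' (T f) = A' f := by
  have hT' : ∀ g, T (j g) = j (Γ g) := fun g => DFunLike.congr_fun hT g
  have hA' : ∀ g, A' (j g) = j (A g) := fun g => DFunLike.congr_fun hA g
  have h1 : ∀ g, Γ g - μ • Γ (A g) = A g := fun g => DFunLike.congr_fun hΓ.1 g
  have h2 : ∀ g, Γ g - μ • A (Γ g) = A g := fun g => DFunLike.congr_fun hΓ.2 g
  constructor
  · refine congrFun (hj.equalizer (g := fun f => T f - μ • T (A' f)) (by fun_prop) A'.continuous
      (funext fun g => ?_)) f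
    simp only [Function.comp_apply]
    rw [hA', hT', hT', ← map_smul, ← map_sub, h1]
  · refine congrFun (hj.equalizer (g := fun f => T f - μ • A' (T f)) (by fun_prop) A'.continuous
      (funext fun g => ?_)) f
    simp only [Function.comp_apply]
    rw [hA', hT', hA', ← map_smul, ← map_sub, h2]

/-- The identities say that `1 + μT` is a two-sided inverse of `1 - μA'` and that `T = (1 + μT) A'`.
-/
theorem eq_resolvent_iff
    (hid : ∀ f, T f - μ • T (A' f) = A' f ∧ T f - μ • A' (T f) = A' f) (f u : WL1 Ω γ) :
    u = T f ↔ u = μ • A' u + A' f := by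
  constructor
  · rintro rfl
    rw [← (hid f).2]
    module
  · intro h
    have h1 := (hid u).1
    have h2 := (hid f).1
    have h3 : T u = μ • T (A' u) + T (A' f) := by
      conv_lhs => rw [h]
      rw [map_add, map_smul]
    have h4 : A' u = T (A' f) := by
      rw [← h1, h3]
      module
    calc u = μ • T (A' f) + A' f := by rw [← h4]; exact h
      _ = T f := by
        rw [← sub_eq_iff_eq_add'.1 h2]

theorem isGreenSol_iff [Nonempty (Fin n)] (hΩo : IsOpen Ω) (hΩb : Bornology.IsBounded Ω)
    (hA' : IsKernelOp (volume.restrict Ω) G A') (f u : WL1 Ω γ) :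
    IsGreenSol G μ f u ↔ u = μ • A' u + A' f := by
  rw [WL1.ext_iff_ae]
  have h1 : (μ • A' u + A' f : WL1 Ω γ) =ᵐ[volume.restrict Ω]
      fun x => μ * greenOp Ω G u x + greenOp Ω G f x := by
    have hac := (ac_weightedMeasure (γ := γ) hΩo hΩb).ae_le
    filter_upwards [hac (Lp.coeFn_add (μ • A' u) (A' f)), hac (Lp.coeFn_smul μ (A' u)),
      (hA' u).2, (hA' f).2] with x h1 h2 h3 h4
    rw [h1, Pi.add_apply, h2, Pi.smul_apply, h3, h4]
    rfl
  constructor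
  · rintro ⟨-, -, h⟩
    exact EventuallyEq.trans h h1.symm
  · intro h
    exact ⟨(hA' u).1, (hA' f).1, h.trans h1⟩

theorem BoundedByWeight.of_mem_weightedLinfty {ψ : L2 Ω} (hψ : ψ ∈ weightedLinfty Ω γ) :
    ∃ C, BoundedByWeight Ω γ C ψ := by
  obtain ⟨C, hC⟩ := hψ
  exact ⟨C, Lp.aestronglyMeasurable ψ, hC⟩

theorem integral_inclusion_mul
    (hj : ∀ g, j g =ᵐ[volume.restrict Ω] g) (f g : L2 Ω) :
    ∫ x in Ω, j f x * g x = inner ℝ f g := by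
  rw [L2.inner_def]
  refine integral_congr_ae ?_
  filter_upwards [hj f] with x hx
  simp [hx, mul_comm]

/-- By symmetry of `Γ`, pairing `Γ ψ` with `f` equals pairing `ψ` with `T (j f)`, which is at most a
constant times `‖j f‖`; the dual bound then applies. -/
theorem resolvent_boundedByWeight [Nonempty (Fin n)] (hΩo : IsOpen Ω)
    (hΩb : Bornology.IsBounded Ω) (hΓ : ∀ f g, inner ℝ (Γ f) g = inner ℝ f (Γ g))
    (hj : ∀ g, j g =ᵐ[volume.restrict Ω] g) (hT : T ∘L j = j ∘L Γ) {ψ : L2 Ω} {C : ℝ}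
    (hψ : BoundedByWeight Ω γ C ψ) : ∃ C', BoundedByWeight Ω γ C' (Γ ψ) := by
  obtain ⟨Λ, hΛ⟩ := hψ.exists_functional hΩo hΩb
  refine ⟨‖Λ ∘L T‖, boundedByWeight_of_dual_bound hΩb hj (Γ ψ) fun f => ?_⟩
  have h1 : inner ℝ (Γ ψ) f = (Λ ∘L T) (j f) := by
    have h2 : T (j f) = j (Γ f) := DFunLike.congr_fun hT f
    rw [ContinuousLinearMap.comp_apply, hΛ, h2, integral_inclusion_mul hj, hΓ, real_inner_comm]
  rw [h1, ← Real.norm_eq_abs]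
  exact (Λ ∘L T).le_opNorm _

theorem integral_extension_mul [Nonempty (Fin n)] (hΩo : IsOpen Ω) (hΩb : Bornology.IsBounded Ω)
    (hΓ : ∀ f g, inner ℝ (Γ f) g = inner ℝ f (Γ g)) (hj : ∀ g, j g =ᵐ[volume.restrict Ω] g)
    (hjd : DenseRange j) (hT : T ∘L j = j ∘L Γ) {ψ : L2 Ω} {C C' : ℝ}
    (hψ : BoundedByWeight Ω γ C ψ) (hψ' : BoundedByWeight Ω γ C' (Γ ψ)) (f : WL1 Ω γ) :
    ∫ x in Ω, T f x * ψ x = ∫ x in Ω, f x * Γ ψ x := by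
  obtain ⟨Λ, hΛ⟩ := hψ.exists_functional hΩo hΩb
  obtain ⟨Λ', hΛ'⟩ := hψ'.exists_functional hΩo hΩb
  rw [← hΛ, ← hΛ']
  refine congrFun (hjd.equalizer (g := fun f => Λ (T f)) (by fun_prop) Λ'.continuous
    (funext fun g => ?_)) f
  have h2 : T (j g) = j (Γ g) := DFunLike.congr_fun hT g
  simp only [Function.comp_apply]
  rw [hΛ, hΛ', h2, integral_inclusion_mul hj, integral_inclusion_mul hj, hΓ]

theorem isResolventWeakSol_iff [Nonempty (Fin n)] (hΩo : IsOpen Ω) (hΩb : Bornology.IsBounded Ω)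
    (hγ : 0 ≤ γ) (hΓ : ∀ g, HasSum (resolventTerm lam φ μ g) (Γ g))
    (hj : ∀ g, j g =ᵐ[volume.restrict Ω] g) (hjd : DenseRange j) (hT : T ∘L j = j ∘L Γ)
    (f u : WL1 Ω γ) : IsResolventWeakSol lam φ μ f u ↔ u = T f := by
  have hΓs := inner_resolvent_comm hΓ
  constructor
  · intro h
    rw [← sub_eq_zero]
    refine WL1.eq_zero_of_integral_mul_eq_zero _ fun ψ C hψ => ?_
    obtain ⟨D, hD0, hD, -⟩ := exists_diameter_bound hΩb
    have hmem : MemLp ψ 2 (volume.restrict Ω) := by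
      refine memLp_two_of_bound hΩb hψ.1 (C := |C| * D ^ γ) ?_
      filter_upwards [hψ.2, ae_restrict_mem hΩo.measurableSet] with x h1 h2
      have := bdist_nonneg Ω x
      refine h1.trans (mul_le_mul (le_abs_self C)
        (Real.rpow_le_rpow this (hD x h2) hγ) (by positivity) (abs_nonneg C))
    have hψ' := hmem.coeFn_toLp
    have hψb : BoundedByWeight Ω γ C (hmem.toLp ψ) := ⟨Lp.aestronglyMeasurable _, by
      filter_upwards [hψ', hψ.2] with x h1 h2
      rwa [h1]⟩
    obtain ⟨C', hC'⟩ := resolvent_boundedByWeight hΩo hΩb hΓs hj hT hψb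
    obtain ⟨-, -, h3⟩ := h (hmem.toLp ψ) ⟨C, hψb.2⟩
    rw [resolventL2_eq hΓ, ← integral_extension_mul hΩo hΩb hΓs hj hjd hT hψb hC'] at h3
    obtain ⟨Λ, hΛ⟩ := hψb.exists_functional hΩo hΩb
    have h4 : ∀ v : WL1 Ω γ, ∫ x in Ω, v x * ψ x = Λ v := fun v => by
      rw [hΛ]
      refine integral_congr_ae ?_
      filter_upwards [hψ'] with x hx
      rw [hx]
    rw [h4, map_sub, hΛ, hΛ, h3, sub_self]
  · rintro rfl ψ hψ
    obtain ⟨C, hC⟩ := BoundedByWeight.of_mem_weightedLinfty hψ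
    obtain ⟨C', hC'⟩ := resolvent_boundedByWeight hΩo hΩb hΓs hj hT hC
    rw [resolventL2_eq hΓ]
    exact ⟨hC.integrable_mul hΩo hΩb _, hC'.integrable_mul hΩo hΩb _,
      integral_extension_mul hΩo hΩb hΓs hj hjd hT hC hC' f⟩

/-- The defect in the weak identity is the pairing of `ψ` with the residual of the Green equation,
so the weak notions over `G` only differ in how many `ψ` annihilate that residual. -/
theorem K1.integral_weak_form (hn : 1 ≤ n) (hs : 0 < s) (hγ : γ ∈ Ioc (0 : ℝ) 1) (hΩo : IsOpen Ω)
    (hΩb : Bornology.IsBounded Ω) (hK : K1 Ω s γ L G)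
    (hA' : IsKernelOp (volume.restrict Ω) G A') {ψ : E n → ℝ} {C : ℝ}
    (hψ : BoundedByWeight Ω γ C ψ) (μ : ℝ) (f u : WL1 Ω γ) :
    IntegrableOn (fun x => u x * (ψ x - μ * greenOp Ω G ψ x)) Ω ∧
    IntegrableOn (fun x => f x * greenOp Ω G ψ x) Ω ∧
    ∫ x in Ω, (u - (μ • A' u + A' f)) x * ψ x =
      (∫ x in Ω, u x * (ψ x - μ * greenOp Ω G ψ x)) - ∫ x in Ω, f x * greenOp Ω G ψ x := by
  have : Nonempty (Fin n) := ⟨⟨0, hn⟩⟩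
  obtain ⟨hiu, hu⟩ := hK.integral_green_mul hn hs hγ hΩo hΩb hA' hψ u
  obtain ⟨hif, hf⟩ := hK.integral_green_mul hn hs hγ hΩo hΩb hA' hψ f
  have hiuψ := hψ.integrable_mul hΩo hΩb u
  have e : (fun x => u x * (ψ x - μ * greenOp Ω G ψ x)) =
      fun x => u x * ψ x - μ * (u x * greenOp Ω G ψ x) := by
    ext x
    ring
  refine ⟨?_, hif, ?_⟩
  · rw [e]
    exact hiuψ.sub (hiu.const_mul μ)
  · obtain ⟨Λ, hΛ⟩ := hψ.exists_functional hΩo hΩb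
    rw [e, integral_sub hiuψ (hiu.const_mul μ), integral_const_mul, ← hu, ← hf, ← hΛ, ← hΛ, ← hΛ,
      ← hΛ, map_sub, map_add, map_smul, smul_eq_mul]
    ring

theorem isSpectralSol_iff_eq_resolvent (hμ : μ ∉ range lam)
    (hΓ : ∀ g, HasSum (resolventTerm lam φ μ g) (Γ g)) (f u : L2 Ω) :
    IsSpectralSol lam φ μ f u ↔ u = Γ f := by
  have hin : ∀ (v : L2 Ω) (k : ℕ), ∫ x in Ω, v x * φ k x = inner ℝ v (φ k) := fun v k => by
    rw [L2.inner_def]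
    refine integral_congr_ae (Eventually.of_forall fun x => ?_)
    simp [mul_comm]
  have hne : ∀ k, lam k - μ ≠ 0 := fun k => sub_ne_zero.2 fun h => hμ ⟨k, h⟩
  simp only [IsSpectralSol, hin]
  constructor
  · intro h
    refine φ.repr.injective (lp.ext (funext fun k => ?_))
    rw [φ.repr_apply_apply, φ.repr_apply_apply, real_inner_comm, real_inner_comm (Γ f),
      inner_resolvent hΓ, eq_div_iff (hne k), mul_comm]
    exact h k
  · rintro rfl k
    rw [inner_resolvent hΓ, mul_div_cancel₀ _ (hne k)]

theorem isSpectralSol_congr {f f' u u' : E n → ℝ} (hf : f =ᵐ[volume.restrict Ω] f')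
    (hu : u =ᵐ[volume.restrict Ω] u') :
    IsSpectralSol lam φ μ f u ↔ IsSpectralSol lam φ μ f' u' := by
  have h : ∀ {v v' : E n → ℝ}, v =ᵐ[volume.restrict Ω] v' → ∀ k,
      ∫ x in Ω, v x * φ k x = ∫ x in Ω, v' x * φ k x := fun hv k => by
    refine integral_congr_ae ?_
    filter_upwards [hv] with x hx
    rw [hx]
  simp only [IsSpectralSol, h hf, h hu]

theorem isSpectralSol_iff
    (hμ : μ ∉ range lam) (hΓ : ∀ g, HasSum (resolventTerm lam φ μ g) (Γ g))
    (hj : ∀ g, j g =ᵐ[volume.restrict Ω] g) (hT : T ∘L j = j ∘L Γ) {f u : WL1 Ω γ}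
    (hf : MemLp f 2 (volume.restrict Ω)) (hu : MemLp u 2 (volume.restrict Ω)) :
    IsSpectralSol lam φ μ f u ↔ u = T f := by
  have hjf : f = j (hf.toLp _) := (WL1.ext_iff_ae).2
    (hf.coeFn_toLp.symm.trans (hj _).symm)
  have hTj : T (j (hf.toLp _)) = j (Γ (hf.toLp _)) := DFunLike.congr_fun hT _
  rw [isSpectralSol_congr hf.coeFn_toLp.symm hu.coeFn_toLp.symm,
    isSpectralSol_iff_eq_resolvent hμ hΓ, WL1.ext_iff_ae]
  conv_rhs => rw [hjf, hTj]
  constructor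
  · intro h
    rw [← h]
    exact hu.coeFn_toLp.symm.trans (hj _).symm
  · intro h
    exact Lp.ext (hu.coeFn_toLp.trans (h.trans (hj _)))

end GreenNotions

/-! ### Assembly of the main theorem -/

theorem mainTheorem7 (n : ℕ) (hn : 1 ≤ n) (s γ : ℝ) (hs : s ∈ Set.Ioo (0 : ℝ) 1)
    (hγ : γ ∈ Set.Ioc (0 : ℝ) 1) (hns : (n : ℝ) ≠ 2 * s)
    (Ω : Set (GreenNotions.E n)) (hΩo : IsOpen Ω) (hΩb : Bornology.IsBounded Ω)
    (hΩn : Ω.Nonempty)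
    (L : GreenNotions.L2 Ω →ₗ.[ℝ] GreenNotions.L2 Ω)
    (G : GreenNotions.E n → GreenNotions.E n → ℝ) (hK1 : GreenNotions.K1 Ω s γ L G) :
    -- `𝔾₀` is defined on `L¹(Ω; δ^γ)`, and a standard eigenbasis exists
    (∀ g : GreenNotions.WL1 Ω γ, GreenNotions.GreenDefined Ω G g) ∧
    (∃ (lam : ℕ → ℝ) (φ : HilbertBasis ℕ ℝ (GreenNotions.L2 Ω)),
      GreenNotions.IsEigenbasis L lam φ) ∧
    -- for every eigenbasis and every `μ` outside the spectrum
    ∀ (lam : ℕ → ℝ) (φ : HilbertBasis ℕ ℝ (GreenNotions.L2 Ω)),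
      GreenNotions.IsEigenbasis L lam φ → ∀ μ : ℝ, μ ∉ Set.range lam →
      -- `𝔾_μ` is defined on `L²(Ω)` and has a unique bounded extension to `L¹(Ω; δ^γ)`
      (∀ g : GreenNotions.L2 Ω, Summable (GreenNotions.resolventTerm lam φ μ g)) ∧
      (∃! T : GreenNotions.WL1 Ω γ →L[ℝ] GreenNotions.WL1 Ω γ,
        GreenNotions.IsResolventExtension lam φ μ T) ∧
      ∀ T : GreenNotions.WL1 Ω γ →L[ℝ] GreenNotions.WL1 Ω γ,
        GreenNotions.IsResolventExtension lam φ μ T →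
        ∀ f u : GreenNotions.WL1 Ω γ,
          -- the five notions are equivalent
          [GreenNotions.IsResolventGreenSol T f u,
            GreenNotions.IsResolventWeakSol lam φ μ f u,
            GreenNotions.IsGreenWeakSol G (GreenNotions.MemLinftyC Ω) μ f u,
            GreenNotions.IsGreenWeakSol G (GreenNotions.MemSmoothC Ω) μ f u,
            GreenNotions.IsGreenSol G μ f u].TFAE ∧
          -- and, in the `L²` setting, equivalent to being a spectral solution
          (MeasureTheory.MemLp f 2 (MeasureTheory.volume.restrict Ω) →
            GreenNotions.MemH2 lam φ u →
            [GreenNotions.IsResolventGreenSol T f u,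
              GreenNotions.IsResolventWeakSol lam φ μ f u,
              GreenNotions.IsGreenWeakSol G (GreenNotions.MemLinftyC Ω) μ f u,
              GreenNotions.IsGreenWeakSol G (GreenNotions.MemSmoothC Ω) μ f u,
              GreenNotions.IsGreenSol G μ f u,
              GreenNotions.IsSpectralSol lam φ μ f u].TFAE) := by
  have hne : Nonempty (Fin n) := ⟨⟨0, hn⟩⟩
  obtain ⟨j, hj'⟩ := GreenNotions.exists_inclusion (Ω := Ω) (γ := γ) hΩo hΩb hγ.1.le
  have hj : ∀ g, j g =ᵐ[volume.restrict Ω] g := fun g =>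
    (GreenNotions.ac_weightedMeasure hΩo hΩb).ae_le (hj' g)
  have hjd : DenseRange j := GreenNotions.denseRange_inclusion hΩb hj'
  obtain ⟨A, A', hA, hA', hdec⟩ := hK1.exists_green_operators hn hs.1 hγ hΩo hΩb hj
  have hsymm := hK1.isSymmetric hn hs.1 hγ hΩo hΩb hA
  -- `A` is the norm limit of the compact far parts, the near parts having norm at most `1/(k+1)`.
  have hcomp : IsCompactOperator A := by
    choose R R' B hR hR' hAB hA'B hjR hc using fun k : ℕ => hdec (1 / ((k : ℝ) + 1)) (by positivity)
    refine isCompactOperator_of_tendsto (F := fun k => B k ∘L j) (l := atTop) ?_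
      (Eventually.of_forall hc)
    rw [tendsto_iff_norm_sub_tendsto_zero]
    refine squeeze_zero (fun k => norm_nonneg _) (fun k => ?_)
      tendsto_one_div_add_atTop_nhds_zero_nat
    rw [norm_sub_rev, hAB k, add_sub_cancel_right]
    exact hR k
  have hAj : A' ∘L j = j ∘L A := by
    ext1 f
    refine (GreenNotions.WL1.ext_iff_ae).2 ?_
    exact (hA'.ae_eq hA (hj f)).trans (hj (A f)).symm
  refine ⟨fun g => (hA' g).1, hK1.exists_isEigenbasis hΩo hΩb hΩn hA hcomp hsymm,
    fun lam φ hφ μ hμ => ?_⟩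
  obtain ⟨Γ, hΓ⟩ := hφ.exists_resolvent hμ
  have hid := GreenNotions.resolvent_identity hφ.pos hμ hΓ (hφ.green_apply hK1.green hA)
  refine ⟨fun g => (hΓ g).summable, ?_, fun T hT f u => ?_⟩
  -- This threshold makes `‖μ R‖` and `‖μ R'‖` less than `1`; the `+ 1` covers `μ = 0`.
  · obtain ⟨R, R', B, hR, hR', hAB, hA'B, hjR, -⟩ := hdec (1 / (|μ| + 1)) (by positivity)
    have hlt : ∀ x : ℝ, x ≤ 1 / (|μ| + 1) → |μ| * x < 1 := fun x hx => by
      calc |μ| * x ≤ |μ| * (1 / (|μ| + 1)) := by gcongr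
        _ < 1 := by
          rw [mul_one_div, div_lt_one (by positivity)]
          exact lt_add_one _
    obtain ⟨T, hT⟩ := GreenNotions.exists_intertwined_resolvent j A R Γ A' R' B μ hAB hA'B hjR
      (by rw [norm_smul]; exact hlt _ hR) (by rw [norm_smul]; exact hlt _ hR') hid.1 hid.2
    refine ⟨T, (GreenNotions.isResolventExtension_iff hΓ hj T).2 hT, fun T' hT' => ?_⟩
    have h := (GreenNotions.isResolventExtension_iff hΓ hj T').1 hT'
    refine DFunLike.coe_injective (hjd.equalizer T'.continuous T.continuous (funext fun g => ?_))
    exact DFunLike.congr_fun (h.trans hT.symm) g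
  · have hTj := (GreenNotions.isResolventExtension_iff hΓ hj T).1 hT
    have h1 : GreenNotions.IsResolventGreenSol T f u ↔ u = T f :=
      (GreenNotions.WL1.ext_iff_ae).symm
    have h2 := GreenNotions.isResolventWeakSol_iff hΩo hΩb hγ.1.le hΓ hj hjd hTj f u
    have h5 : GreenNotions.IsGreenSol G μ f u ↔ u = T f :=
      (GreenNotions.isGreenSol_iff hΩo hΩb hA' f u).trans (GreenNotions.eq_resolvent_iff
        (GreenNotions.extension_identity hjd hTj hAj hid) f u).symm
    have h3 : GreenNotions.IsGreenSol G μ f u →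
        GreenNotions.IsGreenWeakSol G (GreenNotions.MemLinftyC Ω) μ f u := fun h ψ hψ => by
      obtain ⟨C, hC⟩ := hψ.exists_boundedByWeight (γ := γ) hΩo hΩb
      obtain ⟨hi, hi', he⟩ := hK1.integral_weak_form hn hs.1 hγ hΩo hΩb hA' hC μ f u
      refine ⟨hi, hi', ?_⟩
      rw [sub_eq_zero.2 ((GreenNotions.isGreenSol_iff hΩo hΩb hA' f u).1 h)] at he
      obtain ⟨Λ, hΛ⟩ := hC.exists_functional hΩo hΩb
      rw [← hΛ, map_zero] at he
      exact (sub_eq_zero.1 he.symm)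
    have h4 : GreenNotions.IsGreenWeakSol G (GreenNotions.MemLinftyC Ω) μ f u →
        GreenNotions.IsGreenWeakSol G (GreenNotions.MemSmoothC Ω) μ f u := fun h ψ hψ =>
      h ψ hψ.memLinftyC
    -- The step that closes the cycle: the smallest test class already forces the residual to
    -- vanish.
    have h45 : GreenNotions.IsGreenWeakSol G (GreenNotions.MemSmoothC Ω) μ f u →
        GreenNotions.IsGreenSol G μ f u := fun h => by
      rw [GreenNotions.isGreenSol_iff hΩo hΩb hA', ← sub_eq_zero]
      refine GreenNotions.WL1.eq_zero_of_integral_smooth_eq_zero hΩo hΩb _ fun ψ hψ => ?_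
      obtain ⟨C, hC⟩ := hψ.memLinftyC.exists_boundedByWeight (γ := γ) hΩo hΩb
      obtain ⟨-, -, he⟩ := hK1.integral_weak_form hn hs.1 hγ hΩo hΩb hA' hC μ f u
      rw [he, (h ψ hψ).2.2, sub_self]
    constructor
    · tfae_have 1 ↔ 2 := h1.trans h2.symm
      tfae_have 1 ↔ 5 := h1.trans h5.symm
      tfae_have 5 → 3 := h3
      tfae_have 3 → 4 := h4
      tfae_have 4 → 5 := h45
      tfae_finish
    · intro hf hu
      have h6 := GreenNotions.isSpectralSol_iff hμ hΓ hj hTj hf hu.1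
      tfae_have 1 ↔ 2 := h1.trans h2.symm
      tfae_have 1 ↔ 5 := h1.trans h5.symm
      tfae_have 5 → 3 := h3
      tfae_have 3 → 4 := h4
      tfae_have 4 → 5 := h45
      tfae_have 1 ↔ 6 := h1.trans h6.symm
      tfae_finish
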